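/- Let $P$ be a finite poset that is graded of rank one, i.e., every maximal chain of $P$ has exactly two elements. Let $H$ be the Hasse diagram of $P$, regarded as a simple graph on the vertex set $V=P$ (with $u,v$ adjacent if one covers the other); for $W\subseteq V$ let $H_W$ be the induced subgraph of $H$ on $W$, and let $\chi_{H_W}$ be its chromatic polynomial. Let $\mathcal{O}(P)\subset\mathbb{R}^P$ be the order polytope of $P$, i.e., the set of all order-preserving maps $P\to[0,1]$. Let $\mathrm{vis}(\mathcal{O}(P))$ be its visibility arrangement, i.e., the (finite) set of affine spans of the facets of $\mathcal{O}(P)$, and let $\chi_{\mathrm{vis}(\mathcal{O}(P))}(q)=\sum_{X}\mu(\hat 0,X)\,q^{\dim X}$ be its characteristic polynomial, where $X$ ranges over the poset of all nonempty intersections of hyperplanes of the arrangement (including $\hat 0=\mathbb{R}^P$) ordered by reverse inclusion and $\mu$ is the Möbius function of this poset. Let $v(\mathcal{O}(P))$ be the number of regions (connected components of the complement) of $\mathrm{vis}(\mathcal{O}(P))$. Then $$\chi_{\mathrm{vis}(\mathcal{O}(P))}(q)=\sum_{W\subseteq V}\chi_{H_W}(q-2),\qquad v(\mathcal{O}(P))=(-1)^{\#P}\sum_{W\subseteq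 V}\chi_{H_W}(-3),$$ and $v(\mathcal{O}(P))$ is also the number of visibility sets of facets of $\mathcal{O}(P)$, i.e., of sets of the form "all facets of $\mathcal{O}(P)$ visible from the outside from $x$" with $x\in\mathbb{R}^P$. Here a facet $F$ of $\mathcal{O}(P)$ is visible from $x$ if $x\notin\mathcal{O}(P)$ and, for every $y\in F$, no point of $\mathcal{O}(P)$ lies strictly between $x$ and $y$. -/

import Mathlib

/-! ### Chromatic polynomial of a finite simple graph -/

theorem exists_polynomial_card_maps {V : Type*} [Finite V] (L : List (V × V)) :
    ∀ r : V → V → Prop, ∃ p : Polynomial ℤ, ∀ q : ℕ,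
      p.eval (q : ℤ) = (Nat.card {f : V → Fin q //
        (∀ a b, r a b → f a = f b) ∧ ∀ e ∈ L, f e.1 ≠ f e.2} : ℤ) := by
  induction L with
  | nil =>
    intro r
    refine ⟨Polynomial.X ^ Nat.card (Quot r), fun q => ?_⟩
    have e : {f : V → Fin q // (∀ a b, r a b → f a = f b) ∧
        ∀ e ∈ ([] : List (V × V)), f e.1 ≠ f e.2} ≃ (Quot r → Fin q) :=
      { toFun := fun f => Quot.lift f.1 f.2.1
        invFun := fun g => ⟨fun v => g (Quot.mk r v),
          fun a b h => congrArg g (Quot.sound h), by simp⟩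
        left_inv := fun f => rfl
        right_inv := fun g => by funext x; induction x using Quot.ind; rfl }
    rw [Nat.card_congr e, Nat.card_fun]
    simp
  | cons e L ih =>
    intro r
    obtain ⟨p₁, h₁⟩ := ih r
    obtain ⟨p₂, h₂⟩ := ih (fun a b => r a b ∨ (a = e.1 ∧ b = e.2))
    refine ⟨p₁ - p₂, fun q => ?_⟩
    rw [Polynomial.eval_sub, h₁, h₂, sub_eq_iff_eq_add]
    norm_cast
    rw [← Set.coe_ofPred, ← Set.coe_ofPred, ← Set.coe_ofPred, Nat.card_coe_set_eq, Nat.card_coe_set_eq,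
      Nat.card_coe_set_eq, ← Set.ncard_union_eq _ (Set.toFinite _) (Set.toFinite _)]
    · congr 1
      ext f
      simp only [Set.mem_ofPred_eq, Set.mem_union, List.forall_mem_cons]
      constructor
      · rintro ⟨h, h'⟩
        by_cases he : f e.1 = f e.2
        · refine Or.inr ⟨fun a b hab => ?_, h'⟩
          rcases hab with hab | ⟨rfl, rfl⟩
          exacts [h a b hab, he]
        · exact Or.inl ⟨h, he, h'⟩
      · rintro (⟨h, -, h'⟩ | ⟨h, h'⟩)
        exacts [⟨h, h'⟩, ⟨fun a b hab => h a b (Or.inl hab), h'⟩]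
    · rw [Set.disjoint_left]
      rintro f ⟨-, h⟩ ⟨h', -⟩
      exact h e (by simp) (h' e.1 e.2 (Or.inr ⟨rfl, rfl⟩))

/-- The number of proper colorings of a finite graph with `q` colors is a polynomial in `q`. -/
theorem SimpleGraph.exists_chromaticPolynomial {V : Type*} [Finite V] (G : SimpleGraph V) :
    ∃ p : Polynomial ℤ, ∀ q : ℕ, p.eval (q : ℤ) = (Nat.card (G.Coloring (Fin q)) : ℤ) := by
  classical
  have := Fintype.ofFinite V
  obtain ⟨p, hp⟩ := exists_polynomial_card_maps
    ((Finset.univ.filter fun e : V × V => G.Adj e.1 e.2).toList) (fun _ _ => False)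
  refine ⟨p, fun q => ?_⟩
  rw [hp q]
  congr 1
  exact Nat.card_congr
    { toFun := fun f => SimpleGraph.Coloring.mk f.1 fun {v w} h => f.2.2 (v, w) (by simpa using h)
      invFun := fun c => ⟨c, by simp, fun e he => c.valid (by simpa using he)⟩
      left_inv := fun f => rfl
      right_inv := fun c => rfl }

/-- The chromatic polynomial of a finite simple graph: the polynomial whose value at each natural
number `q` is the number of proper colorings with `q` colors. -/
noncomputable def SimpleGraph.chromaticPolynomial {V : Type*} [Finite V] (G : SimpleGraph V) :
    Polynomial ℤ :=
  G.exists_chromaticPolynomial.choose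

theorem SimpleGraph.eval_chromaticPolynomial {V : Type*} [Finite V] (G : SimpleGraph V) (q : ℕ) :
    G.chromaticPolynomial.eval (q : ℤ) = (Nat.card (G.Coloring (Fin q)) : ℤ) :=
  G.exists_chromaticPolynomial.choose_spec q

/-! ### Arrangements of affine subspaces -/

/-- The intersection poset `L(A)`: all nonempty intersections of members of `A` (including the
whole space, as the empty intersection), ordered by reverse inclusion. -/
abbrev IntersectionPoset {E : Type*} [AddCommGroup E] [Module ℝ E]
    (A : Set (AffineSubspace ℝ E)) : Type _ :=
  {X : AffineSubspace ℝ E // (X : Set E).Nonempty ∧ ∃ B ⊆ A, X = sInf B}ᵒᵈ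

theorem IntersectionPoset.finite {E : Type*} [AddCommGroup E] [Module ℝ E]
    {A : Set (AffineSubspace ℝ E)} (hA : A.Finite) : Finite (IntersectionPoset A) :=
  Set.Finite.to_subtype <| (hA.finite_subsets.image sInf).subset <| by
    rintro X ⟨-, B, hB, rfl⟩
    exact ⟨B, hB, rfl⟩

/-- The minimum of the intersection poset: the whole space. -/
def IntersectionPoset.whole {E : Type*} [AddCommGroup E] [Module ℝ E]
    (A : Set (AffineSubspace ℝ E)) : IntersectionPoset A :=
  OrderDual.toDual ⟨⊤, ⟨0, trivial⟩, ∅, Set.empty_subset A, sInf_empty.symm⟩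

open Classical in
/-- The characteristic polynomial `∑ X ∈ L(A), μ(0̂, X) q ^ dim X` of a finite arrangement `A`,
where `μ` is the Möbius function of the intersection poset. -/
noncomputable def characteristicPolynomial {E : Type*} [AddCommGroup E] [Module ℝ E]
    [FiniteDimensional ℝ E] (A : Set (AffineSubspace ℝ E)) (hA : A.Finite) : Polynomial ℤ :=
  letI : Finite (IntersectionPoset A) := IntersectionPoset.finite hA
  letI : Fintype (IntersectionPoset A) := Fintype.ofFinite _
  letI : LocallyFiniteOrder (IntersectionPoset A) := Fintype.toLocallyFiniteOrder
  ∑ X : IntersectionPoset A,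
    Polynomial.C (IncidenceAlgebra.mu ℤ (IntersectionPoset.whole A) X) *
      Polynomial.X ^ Module.finrank ℝ (OrderDual.ofDual X).1.direction

/-- The regions of an arrangement: the connected components of the complement of the union of its
members. -/
def regions {E : Type*} [NormedAddCommGroup E] [NormedSpace ℝ E]
    (A : Set (AffineSubspace ℝ E)) : Set (Set E) :=
  {R | ∃ x ∈ (⋃ H ∈ A, (H : Set E))ᶜ, R = connectedComponentIn (⋃ H ∈ A, (H : Set E))ᶜ x}

/-! ### Facets and visibility -/

/-- The facets of a convex polytope `K`: its nonempty (exposed) faces of dimension `dim K - 1`. -/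
def facets {E : Type*} [NormedAddCommGroup E] [NormedSpace ℝ E] (K : Set E) : Set (Set E) :=
  {F | IsExposed ℝ K F ∧ F.Nonempty ∧
    Module.finrank ℝ (affineSpan ℝ F).direction + 1 =
      Module.finrank ℝ (affineSpan ℝ K).direction}

/-- The visibility arrangement of a convex polytope: the affine spans of its facets. -/
def visibilityArrangement {E : Type*} [NormedAddCommGroup E] [NormedSpace ℝ E] (K : Set E) :
    Set (AffineSubspace ℝ E) :=
  (fun F => affineSpan ℝ F) '' facets K

/-- The number `v(K)` of regions of the visibility arrangement. -/
noncomputable def visibilityNumber {E : Type*} [NormedAddCommGroup E] [NormedSpace ℝ E]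
    (K : Set E) : ℕ :=
  (regions (visibilityArrangement K)).ncard

/-- The set of facets of `K` visible (on the outside) from the point `x`: those facets `F` such
that `x` lies outside `K` and, for every `y ∈ F`, no point of `K` lies strictly between `x`
and `y`. -/
def visibleFacets {E : Type*} [NormedAddCommGroup E] [NormedSpace ℝ E] (K : Set E) (x : E) :
    Set (Set E) :=
  {F | F ∈ facets K ∧ x ∉ K ∧ ∀ y ∈ F, IsVisible ℝ K x y}

/-- The visibility sets of facets of `K`: the sets of facets visible from some point. -/
def visibilitySets {E : Type*} [NormedAddCommGroup E] [NormedSpace ℝ E] (K : Set E) :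
    Set (Set (Set E)) :=
  Set.range (visibleFacets K)

/-! ### Posets -/

/-- The order polytope of `P`: the order-preserving maps `P → [0, 1]`. -/
def orderPolytope (P : Type*) [PartialOrder P] : Set (P → ℝ) :=
  {f | Monotone f ∧ ∀ v, f v ∈ Set.Icc (0 : ℝ) 1}

/-- A poset is graded of rank one if every maximal chain has exactly two elements. -/
def IsGradedOfRankOne (P : Type*) [PartialOrder P] : Prop :=
  ∀ C : Set P, IsMaxChain (· ≤ ·) C → C.ncard = 2

/-!
By Whitney's formula the characteristic polynomial of an arrangement of hyperplanes `H i` is the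
sum of `(-1) ^ #B * q ^ dim (⋂ i ∈ B, H i)` over the sets `B` of indices with nonempty
intersection. At `q = -1`, up to sign, deleting a hyperplane and restricting to it change this sum
in the same way as the number of realized sign vectors, which gives Zaslavsky's theorem.

The facet hyperplanes of the order polytope of a poset of rank one are `x a = x b` for `a < b`,
`x a = 0` for `a` minimal and `x b = 1` for `b` not minimal. By inclusion–exclusion, Whitney's sum
at `q + 2` counts the maps to a set of `q + 2` colors, two of which play the roles of `0` and `1`,
that satisfy none of these equations. If `W` is the set of elements without special color, such a
map is a proper coloring of `H_W` with `q` colors: every element outside `W` has the special color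
that its rank leaves it, and these never agree on a pair `a < b`.

A facet is visible from `x` exactly if its inequality fails at `x`, and moving `x` slightly towards
an interior point of the polytope makes the weak inequalities strict, so that the visibility sets
are the realized sign vectors.
-/

open Module

/-! ### Whitney's formula -/

section Whitney

open Finset Polynomial

variable {ι : Type*}

open scoped Classical in
theorem sum_neg_one_pow_card_of_le_inf [Fintype ι] {L : Type*} [SemilatticeInf L] [OrderTop L]
    (H : ι → L) (X : L) :
    ∑ B : Finset ι with X ≤ B.inf H, (-1 : ℤ) ^ #B = if ∀ i, ¬X ≤ H i then 1 else 0 := by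
  have hpowerset : ({B : Finset ι | X ≤ B.inf H} : Finset (Finset ι)) =
      ({i | X ≤ H i} : Finset ι).powerset := by
    ext B
    simp [subset_iff]
  rw [hpowerset, sum_powerset_neg_one_pow_card]
  simp only [filter_eq_empty_iff, mem_univ, forall_const]

namespace IntersectionPoset

variable {E : Type*} [AddCommGroup E] [Module ℝ E] {A : Set (AffineSubspace ℝ E)}

/-- The affine subspace underlying an element of the intersection poset. -/
def flat (X : IntersectionPoset A) : AffineSubspace ℝ E :=
  (OrderDual.ofDual X).1

theorem flat_injective : Function.Injective (flat : IntersectionPoset A → AffineSubspace ℝ E) :=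
  Subtype.val_injective.comp OrderDual.ofDual.injective

theorem flat_le_flat {X Y : IntersectionPoset A} : X.flat ≤ Y.flat ↔ Y ≤ X :=
  Iff.rfl

theorem nonempty_flat (X : IntersectionPoset A) : (X.flat : Set E).Nonempty :=
  (OrderDual.ofDual X).2.1

instance : OrderBot (IntersectionPoset A) where
  bot := whole A
  bot_le X := flat_le_flat.1 (le_top : X.flat ≤ ⊤)

theorem eq_bot_of_forall_not_flat_le {X : IntersectionPoset A} (h : ∀ K ∈ A, ¬X.flat ≤ K) :
    X = ⊥ := by
  obtain ⟨-, B, hB, hX⟩ := (OrderDual.ofDual X).2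
  have hBempty : B = ∅ := Set.eq_empty_of_forall_notMem fun K hK =>
    h K (hB hK) (hX.trans_le (sInf_le hK))
  refine flat_injective ?_
  rw [flat, hX, hBempty, sInf_empty]
  rfl

variable {H : ι → AffineSubspace ℝ E}

theorem exists_flat_eq_inf {B : Finset ι} (hB : ((B.inf H : AffineSubspace ℝ E) : Set E).Nonempty) :
    ∃ X : IntersectionPoset (Set.range H), X.flat = B.inf H :=
  ⟨OrderDual.toDual ⟨B.inf H, hB, H '' B, Set.image_subset_range _ _,
    by rw [Finset.inf_eq_iInf, sInf_image]; rfl⟩, rfl⟩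

variable [Fintype ι]

open scoped Classical in
theorem sum_sum_inf_eq_flat {M : Type*} [AddCommMonoid M]
    (s : Finset (IntersectionPoset (Set.range H))) (f : Finset ι → M) :
    ∑ Y ∈ s, ∑ B with B.inf H = Y.flat, f B = ∑ B with ∃ Y ∈ s, Y.flat = B.inf H, f B := by
  rw [← sum_image (f := fun K => ∑ B with B.inf H = K, f B) flat_injective.injOn]
  convert sum_fiberwise_eq_sum_filter univ (s.image flat) (fun B => B.inf H) f using 2
  simp only [mem_image]

open scoped Classical in
theorem mu_whole [DecidableEq (IntersectionPoset (Set.range H))]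
    [LocallyFiniteOrder (IntersectionPoset (Set.range H))] (hH : ∀ i, H i ≠ ⊤)
    (X : IntersectionPoset (Set.range H)) :
    IncidenceAlgebra.mu ℤ (whole (Set.range H)) X =
      ∑ B : Finset ι with B.inf H = X.flat, (-1) ^ #B := by
  have hsum (X : IntersectionPoset (Set.range H)) : (if X = ⊥ then 1 else 0) =
      ∑ Y ∈ Iic X, ∑ B : Finset ι with B.inf H = Y.flat, (-1 : ℤ) ^ #B := by
    have hmem (B : Finset ι) : (∃ Y ∈ Iic X, Y.flat = B.inf H) ↔ X.flat ≤ B.inf H := by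
      refine ⟨fun ⟨Y, hYX, hY⟩ => hY ▸ flat_le_flat.2 (mem_Iic.1 hYX), fun h => ?_⟩
      obtain ⟨Y, hY⟩ := exists_flat_eq_inf (X.nonempty_flat.mono h)
      exact ⟨Y, mem_Iic.2 (flat_le_flat.1 (hY.symm ▸ h)), hY⟩
    have hbot : X = ⊥ ↔ ∀ i, ¬X.flat ≤ H i := by
      refine ⟨?_, fun h => eq_bot_of_forall_not_flat_le (Set.forall_mem_range.2 h)⟩
      rintro rfl i h
      exact hH i (top_le_iff.1 h)
    simp only [sum_sum_inf_eq_flat, hmem, hbot, sum_neg_one_pow_card_of_le_inf]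
  rw [IncidenceAlgebra.moebius_inversion_bot _ _ hsum X]
  simp only [mul_ite, mul_one, mul_zero, sum_ite_eq', mem_Iic, bot_le, if_true]
  rfl

end IntersectionPoset

variable {𝕜 E : Type*} [Field 𝕜] [AddCommGroup E] [Module 𝕜 E]

open scoped Classical in
/-- The signed sum `∑ (-1) ^ #B * X ^ dim (S ∩ ⋂ i ∈ B, H i)` over the subsets `B` of `s` for which
the intersection is nonempty: Whitney's expression for the characteristic polynomial of the
restriction to `S` of the arrangement `H i`, `i ∈ s`. -/
noncomputable def whitneyPolynomial (H : ι → AffineSubspace 𝕜 E) (s : Finset ι)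
    (S : AffineSubspace 𝕜 E) : ℤ[X] :=
  ∑ B ∈ s.powerset, if ((S ⊓ B.inf H : AffineSubspace 𝕜 E) : Set E).Nonempty then
    C ((-1) ^ #B) * X ^ finrank 𝕜 (S ⊓ B.inf H).direction else 0

theorem whitneyPolynomial_insert [DecidableEq ι] (H : ι → AffineSubspace 𝕜 E) {s : Finset ι}
    (S : AffineSubspace 𝕜 E) {a : ι} (ha : a ∉ s) :
    whitneyPolynomial H (insert a s) S =
      whitneyPolynomial H s S - whitneyPolynomial H s (S ⊓ H a) := by
  unfold whitneyPolynomial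
  rw [sum_powerset_insert ha, sub_eq_add_neg, ← sum_neg_distrib]
  congr 1
  refine sum_congr rfl fun B hB => ?_
  have haB : a ∉ B := fun h => ha (mem_powerset.1 hB h)
  rw [inf_insert, ← inf_assoc, card_insert_of_notMem haB, pow_succ]
  split_ifs <;> simp

theorem characteristicPolynomial_range [Fintype ι] {E : Type*} [AddCommGroup E] [Module ℝ E]
    [FiniteDimensional ℝ E] {H : ι → AffineSubspace ℝ E} (hH : ∀ i, H i ≠ ⊤)
    (hA : (Set.range H).Finite) :
    characteristicPolynomial (Set.range H) hA = whitneyPolynomial H univ ⊤ := by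
  classical
  let _ : Finite (IntersectionPoset (Set.range H)) := IntersectionPoset.finite hA
  let _ : Fintype (IntersectionPoset (Set.range H)) := Fintype.ofFinite _
  let _ : LocallyFiniteOrder (IntersectionPoset (Set.range H)) := Fintype.toLocallyFiniteOrder
  have hmem (B : Finset ι) :
      (∃ Y ∈ (univ : Finset (IntersectionPoset (Set.range H))), Y.flat = B.inf H) ↔
        ((B.inf H : AffineSubspace ℝ E) : Set E).Nonempty := by
    simp only [mem_univ, true_and]
    exact ⟨fun ⟨Y, hY⟩ => hY ▸ Y.nonempty_flat, IntersectionPoset.exists_flat_eq_inf⟩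
  calc
    characteristicPolynomial (Set.range H) hA = ∑ Y : IntersectionPoset (Set.range H),
        C (IncidenceAlgebra.mu ℤ (IntersectionPoset.whole (Set.range H)) Y) *
          X ^ finrank ℝ Y.flat.direction := by
      unfold characteristicPolynomial
      congr!
    _ = ∑ Y : IntersectionPoset (Set.range H), ∑ B : Finset ι with B.inf H = Y.flat,
        C ((-1) ^ #B) * X ^ finrank ℝ (B.inf H).direction := by
      simp_rw [IntersectionPoset.mu_whole hH, map_sum, sum_mul]
      refine sum_congr rfl fun Y _ => sum_congr rfl fun B hB => ?_
      rw [(mem_filter.1 hB).2]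
    _ = ∑ B : Finset ι with ((B.inf H : AffineSubspace ℝ E) : Set E).Nonempty,
        C ((-1) ^ #B) * X ^ finrank ℝ (B.inf H).direction := by
      simp only [IntersectionPoset.sum_sum_inf_eq_flat, hmem]
    _ = whitneyPolynomial H univ ⊤ := by
      rw [whitneyPolynomial, powerset_univ, sum_filter]
      refine sum_congr rfl fun B _ => ?_
      rw [top_inf_eq]

end Whitney

/-! ### Sign patterns and Zaslavsky's theorem -/

section ZeroLocus

variable {𝕜 E : Type*} [Field 𝕜] [AddCommGroup E] [Module 𝕜 E]

/-- The affine subspace on which an affine functional vanishes; it is a hyperplane unless the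
functional is constant. -/
def zeroLocus (f : E →ᵃ[𝕜] 𝕜) : AffineSubspace 𝕜 E where
  carrier := {x | f x = 0}
  smul_vsub_vadd_mem' c x y z hx hy hz := by
    change f (c • (x -ᵥ y) +ᵥ z) = 0
    rw [f.map_vadd, map_smul, f.linearMap_vsub, hx.out, hy.out, hz.out]
    simp

variable {f : E →ᵃ[𝕜] 𝕜} {x y : E}

@[simp]
theorem mem_zeroLocus : x ∈ zeroLocus f ↔ f x = 0 :=
  Iff.rfl

theorem zeroLocus_ne_top (hx : f x ≠ 0) : zeroLocus f ≠ ⊤ := fun h =>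
  hx (mem_zeroLocus.1 (h ▸ AffineSubspace.mem_top 𝕜 E x))

theorem direction_zeroLocus (hx : f x = 0) : (zeroLocus f).direction = LinearMap.ker f.linear := by
  ext v
  rw [← AffineSubspace.vadd_mem_iff_mem_direction v (mem_zeroLocus.2 hx), mem_zeroLocus,
    f.map_vadd, hx, vadd_eq_add, add_zero, LinearMap.mem_ker]

theorem finrank_direction_inf_zeroLocus_add_one [FiniteDimensional 𝕜 E] {S : AffineSubspace 𝕜 E}
    (hxS : x ∈ S) (hx : f x = 0) (hyS : y ∈ S) (hy : f y ≠ 0) :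
    finrank 𝕜 (S ⊓ zeroLocus f).direction + 1 = finrank 𝕜 S.direction := by
  have hlinear : f.linear ∘ₗ S.direction.subtype ≠ 0 := fun h => by
    have hvsub : f.linear (y -ᵥ x) = 0 :=
      LinearMap.congr_fun h ⟨y -ᵥ x, AffineSubspace.vsub_mem_direction hyS hxS⟩
    rw [AffineMap.linearMap_vsub, hx, vsub_eq_sub, sub_zero] at hvsub
    exact hy hvsub
  rw [AffineSubspace.direction_inf_of_mem hxS (mem_zeroLocus.2 hx), direction_zeroLocus hx,
    ← Dual.finrank_ker_add_one_of_ne_zero hlinear, LinearMap.ker_comp,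
    ← Submodule.map_comap_subtype, Submodule.finrank_map_subtype_eq]

end ZeroLocus

section SignPatterns

open Finset SignType

variable {𝕜 E ι : Type*} [Field 𝕜] [LinearOrder 𝕜] [AddCommGroup E] [Module 𝕜 E]

/-- The set of the indices in `s` of the functionals that are negative at `x`. It records the
region of the hyperplane arrangement in which a point on none of the hyperplanes lies. -/
def negIndices (l : ι → E →ᵃ[𝕜] 𝕜) (s : Finset ι) (x : E) : Finset ι :=
  {i ∈ s | l i x < 0}

/-- The sign patterns of the functionals with index in `s` that are realized by points of `S` at
which none of these functionals vanishes. A pattern is encoded by its set of negative signs. -/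
def signPatterns (l : ι → E →ᵃ[𝕜] 𝕜) (s : Finset ι) (S : Set E) : Set (Finset ι) :=
  negIndices l s '' {x ∈ S | ∀ i ∈ s, l i x ≠ 0}

variable {l : ι → E →ᵃ[𝕜] 𝕜} {s : Finset ι} {x y : E} {i : ι}

@[simp]
theorem mem_negIndices : i ∈ negIndices l s x ↔ i ∈ s ∧ l i x < 0 :=
  mem_filter

theorem negIndices_congr (h : ∀ i ∈ s, sign (l i x) = sign (l i y)) :
    negIndices l s x = negIndices l s y :=
  filter_congr fun i hi => by rw [← sign_eq_neg_one_iff, h i hi, sign_eq_neg_one_iff]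

theorem finite_signPatterns (l : ι → E →ᵃ[𝕜] 𝕜) (s : Finset ι) (S : Set E) :
    (signPatterns l s S).Finite := by
  refine s.powerset.finite_toSet.subset ?_
  rintro _ ⟨x, -, rfl⟩
  exact mem_powerset.2 (filter_subset _ s)

theorem signPatterns_mono {S T : Set E} (h : S ⊆ T) : signPatterns l s S ⊆ signPatterns l s T :=
  Set.image_mono fun _ hx => ⟨h hx.1, hx.2⟩

theorem ncard_signPatterns_empty {S : Set E} (hS : S.Nonempty) :
    (signPatterns l ∅ S).ncard = 1 := by
  have hconst : negIndices l ∅ = fun _ => ∅ := funext fun x => filter_empty _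
  simp [signPatterns, hconst, hS.image_const]

theorem signPatterns_of_eq_empty {S : Set E} (hS : S = ∅) : signPatterns l s S = ∅ := by
  simp [signPatterns, hS]

theorem signPatterns_insert [DecidableEq ι] (l : ι → E →ᵃ[𝕜] 𝕜) (s : Finset ι) (S : Set E) (a : ι) :
    signPatterns l (insert a s) S = signPatterns l s (S ∩ {x | 0 < l a x}) ∪
      insert a '' signPatterns l s (S ∩ {x | l a x < 0}) := by
  have hneg (x : E) (hx : l a x < 0) : negIndices l (insert a s) x = insert a (negIndices l s x) :=
    (filter_insert ..).trans (if_pos hx)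
  have hpos (x : E) (hx : 0 < l a x) : negIndices l (insert a s) x = negIndices l s x :=
    (filter_insert ..).trans (if_neg hx.not_gt)
  ext N
  constructor
  · rintro ⟨x, ⟨hxS, hx⟩, rfl⟩
    obtain ⟨hxa, hxs⟩ := (forall_mem_insert ..).1 hx
    rcases lt_or_gt_of_ne hxa with h | h
    · exact Or.inr ⟨_, ⟨x, ⟨⟨hxS, h⟩, hxs⟩, rfl⟩, (hneg x h).symm⟩
    · exact Or.inl ⟨x, ⟨⟨hxS, h⟩, hxs⟩, (hpos x h).symm⟩
  · rintro (⟨x, ⟨⟨hxS, h⟩, hxs⟩, rfl⟩ | ⟨_, ⟨x, ⟨⟨hxS, h⟩, hxs⟩, rfl⟩, rfl⟩)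
    · exact ⟨x, ⟨hxS, (forall_mem_insert ..).2 ⟨h.ne', hxs⟩⟩, hpos x h⟩
    · exact ⟨x, ⟨hxS, (forall_mem_insert ..).2 ⟨h.ne, hxs⟩⟩, hneg x h⟩

theorem sign_eq_of_negIndices_eq (hx : ∀ i ∈ s, l i x ≠ 0) (hy : ∀ i ∈ s, l i y ≠ 0)
    (h : negIndices l s x = negIndices l s y) (hi : i ∈ s) : sign (l i x) = sign (l i y) := by
  have hiff : l i x < 0 ↔ l i y < 0 := by
    simpa only [mem_negIndices, hi, true_and] using Finset.ext_iff.1 h i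
  rcases lt_or_gt_of_ne (hx i hi) with hneg | hpos
  · rw [sign_neg hneg, sign_neg (hiff.1 hneg)]
  · rw [sign_pos hpos, sign_pos ((hy i hi).lt_or_gt.resolve_left (hiff.not.1 hpos.not_gt))]

theorem negIndices_mem_signPatterns {S : Set E} (hyS : y ∈ S) (hx : ∀ i ∈ s, l i x ≠ 0)
    (h : ∀ i ∈ s, sign (l i y) = sign (l i x)) : negIndices l s x ∈ signPatterns l s S :=
  ⟨y, ⟨hyS, fun i hi => sign_ne_zero.1 (h i hi ▸ sign_ne_zero.2 (hx i hi))⟩, negIndices_congr h⟩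

theorem ncard_signPatterns_insert_eq_pos_add_neg [DecidableEq ι] {a : ι} (ha : a ∉ s) (S : Set E) :
    (signPatterns l (insert a s) S).ncard =
      (signPatterns l s (S ∩ {x | 0 < l a x})).ncard +
        (signPatterns l s (S ∩ {x | l a x < 0})).ncard := by
  have hnotMem {T : Set E} {N : Finset ι} (hN : N ∈ signPatterns l s T) : a ∉ N := by
    obtain ⟨x, -, rfl⟩ := hN
    exact fun h => ha (mem_negIndices.1 h).1
  rw [signPatterns_insert, Set.ncard_union_eq _ (finite_signPatterns ..)
    ((finite_signPatterns ..).image _), Set.InjOn.ncard_image]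
  · intro N hN M hM h
    rw [← erase_insert (hnotMem hN), ← erase_insert (hnotMem hM), h]
  · rw [Set.disjoint_left]
    rintro _ hN ⟨M, -, rfl⟩
    exact hnotMem hN (mem_insert_self a M)

theorem neg_one_pow_finrank_mul_ncard_signPatterns_inf_zeroLocus {S : AffineSubspace 𝕜 E} {a : ι}
    [FiniteDimensional 𝕜 E] (hyS : y ∈ S) (hya : l a y ≠ 0) :
    (-1) ^ finrank 𝕜 (S ⊓ zeroLocus (l a)).direction *
        ((signPatterns l s (S ⊓ zeroLocus (l a) : AffineSubspace 𝕜 E)).ncard : ℤ) =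
      -((-1) ^ finrank 𝕜 S.direction *
        ((signPatterns l s (S ⊓ zeroLocus (l a) : AffineSubspace 𝕜 E)).ncard : ℤ)) := by
  rcases ((S ⊓ zeroLocus (l a) : AffineSubspace 𝕜 E) : Set E).eq_empty_or_nonempty with h | h
  · simp [signPatterns_of_eq_empty h]
  · obtain ⟨x, hxS, hxa⟩ := h
    rw [← finrank_direction_inf_zeroLocus_add_one hxS hxa hyS hya]
    ring

variable [IsStrictOrderedRing 𝕜]

theorem convex_setOf_sign_eq (σ : SignType) : Convex 𝕜 {a : 𝕜 | sign a = σ} := by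
  cases σ with
  | zero =>
    simp only [zero_eq_zero, sign_eq_zero_iff]
    exact convex_singleton 0
  | neg =>
    simp only [neg_eq_neg_one, sign_eq_neg_one_iff]
    exact convex_Iio 0
  | pos =>
    simp only [pos_eq_one, sign_eq_one_iff]
    exact convex_Ioi 0

theorem exists_forall_sign_lineMap_eq (a b : 𝕜) :
    ∃ ε > 0, ∀ t : 𝕜, 0 < t → t < ε →
      sign (AffineMap.lineMap a b t) = if a = 0 then sign b else sign a := by
  by_cases ha : a = 0
  · refine ⟨1, one_pos, fun t ht _ => ?_⟩
    rw [if_pos ha, ha, AffineMap.lineMap_apply_ring, mul_zero, zero_add, sign_mul, sign_pos ht,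
      one_mul]
  · have hden : 0 < |a| + |b| := add_pos_of_pos_of_nonneg (abs_pos.2 ha) (abs_nonneg b)
    refine ⟨|a| / (|a| + |b|), div_pos (abs_pos.2 ha) hden, fun t ht htε => ?_⟩
    rw [lt_div_iff₀ hden] at htε
    have hb : |t * b| < (1 - t) * |a| := by
      rw [abs_mul, abs_of_pos ht]
      linarith
    rw [if_neg ha, AffineMap.lineMap_apply_ring]
    rcases lt_or_gt_of_ne ha with h | h
    · rw [abs_of_neg h] at hb
      rw [sign_neg h, sign_neg]
      linarith [le_abs_self (t * b)]
    · rw [abs_of_pos h] at hb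
      rw [sign_pos h, sign_pos]
      linarith [neg_abs_le (t * b)]

theorem exists_forall_sign_apply_lineMap_eq (l : ι → E →ᵃ[𝕜] 𝕜) (s : Finset ι) (x y : E) :
    ∃ t : 𝕜, 0 < t ∧ t < 1 ∧ ∀ i ∈ s, sign (l i (AffineMap.lineMap x y t)) =
      if l i x = 0 then sign (l i y) else sign (l i x) := by
  choose ε hε hsign using fun i => exists_forall_sign_lineMap_eq (l i x) (l i y)
  obtain ⟨δ, hδ, hδ1, hδε⟩ : ∃ δ > 0, δ ≤ 1 ∧ ∀ i ∈ s, δ ≤ ε i := by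
    refine ⟨(insert 1 (s.image ε)).min' (insert_nonempty ..), (lt_min'_iff ..).2 ?_,
      min'_le _ _ (mem_insert_self ..),
      fun i hi => min'_le _ _ (mem_insert_of_mem (mem_image_of_mem ε hi))⟩
    simpa using fun i _ => hε i
  refine ⟨δ / 2, half_pos hδ, (half_lt_self hδ).trans_le hδ1, fun i hi => ?_⟩
  rw [AffineMap.apply_lineMap]
  exact hsign i _ (half_pos hδ) ((half_lt_self hδ).trans_le (hδε i hi))

section Insert

variable {a : ι} {S : AffineSubspace 𝕜 E}

theorem exists_mem_sign_eq_of_mem_zeroLocus {σ : SignType} (hσ : σ ≠ 0) (hxS : x ∈ S)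
    (hxa : l a x = 0) (hxs : ∀ i ∈ s, l i x ≠ 0) (hyS : y ∈ S) (hya : l a y ≠ 0) :
    ∃ z ∈ S, sign (l a z) = σ ∧ ∀ i ∈ s, sign (l i z) = sign (l i x) := by
  classical
  obtain ⟨w, hwS, hw⟩ : ∃ w ∈ S, sign (l a w) = σ := by
    by_cases hyσ : sign (l a y) = σ
    · exact ⟨y, hyS, hyσ⟩
    · refine ⟨AffineMap.lineMap x y (-1 : 𝕜), AffineMap.lineMap_mem _ hxS hyS, ?_⟩
      rw [AffineMap.apply_lineMap, hxa, AffineMap.lineMap_apply_ring, mul_zero, zero_add,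
        neg_one_mul, Left.sign_neg]
      have hy0 := sign_ne_zero.2 hya
      generalize sign (l a y) = τ at hyσ hy0
      decide +revert
  obtain ⟨t, -, -, ht⟩ := exists_forall_sign_apply_lineMap_eq l (insert a s) x w
  obtain ⟨hta, hts⟩ := (forall_mem_insert ..).1 ht
  rw [if_pos hxa, hw] at hta
  exact ⟨_, AffineMap.lineMap_mem t hxS hwS, hta,
    fun i hi => (hts i hi).trans (if_neg (hxs i hi))⟩

theorem signPatterns_pos_union_neg (hyS : y ∈ S) (hya : l a y ≠ 0) :
    signPatterns l s (S ∩ {x | 0 < l a x}) ∪ signPatterns l s (S ∩ {x | l a x < 0}) =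
      signPatterns l s S := by
  refine Set.Subset.antisymm (Set.union_subset (signPatterns_mono Set.inter_subset_left)
    (signPatterns_mono Set.inter_subset_left)) ?_
  rintro _ ⟨x, ⟨hxS, hxs⟩, rfl⟩
  rcases lt_trichotomy (l a x) 0 with hxa | hxa | hxa
  · exact Or.inr ⟨x, ⟨⟨hxS, hxa⟩, hxs⟩, rfl⟩
  · obtain ⟨z, hzS, hza, hzs⟩ :=
      exists_mem_sign_eq_of_mem_zeroLocus one_ne_zero hxS hxa hxs hyS hya
    exact Or.inl (negIndices_mem_signPatterns ⟨hzS, sign_eq_one_iff.1 hza⟩ hxs hzs)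
  · exact Or.inl ⟨x, ⟨⟨hxS, hxa⟩, hxs⟩, rfl⟩

theorem signPatterns_pos_inter_neg (hyS : y ∈ S) (hya : l a y ≠ 0) :
    signPatterns l s (S ∩ {x | 0 < l a x}) ∩ signPatterns l s (S ∩ {x | l a x < 0}) =
      signPatterns l s (S ⊓ zeroLocus (l a) : AffineSubspace 𝕜 E) := by
  refine Set.Subset.antisymm ?_ ?_
  · rintro _ ⟨⟨x, ⟨⟨hxS, hxa : 0 < l a x⟩, hxs⟩, rfl⟩, ⟨z, ⟨⟨hzS, hza : l a z < 0⟩, hzs⟩, hzx⟩⟩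
    have hden : 0 < l a x - l a z := by linarith
    obtain ⟨t, ht, hta⟩ : ∃ t ∈ Set.Icc (0 : 𝕜) 1, l a (AffineMap.lineMap x z t) = 0 := by
      refine ⟨l a x / (l a x - l a z), ⟨by positivity, (div_le_one hden).2 (by linarith)⟩, ?_⟩
      rw [AffineMap.apply_lineMap, AffineMap.lineMap_apply_ring]
      field_simp
      ring
    refine negIndices_mem_signPatterns ⟨AffineMap.lineMap_mem t hxS hzS, hta⟩ hxs fun i hi => ?_
    have hsign : sign (l i z) = sign (l i x) := sign_eq_of_negIndices_eq hzs hxs hzx hi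
    exact (((convex_setOf_sign_eq (sign (l i x))).affine_preimage (l i)).lineMap_mem rfl hsign ht :)
  · rintro _ ⟨x, ⟨⟨hxS, hxa⟩, hxs⟩, rfl⟩
    obtain ⟨z, hzS, hza, hzs⟩ :=
      exists_mem_sign_eq_of_mem_zeroLocus one_ne_zero hxS hxa hxs hyS hya
    obtain ⟨w, hwS, hwa, hws⟩ :=
      exists_mem_sign_eq_of_mem_zeroLocus (σ := -1) (by decide) hxS hxa hxs hyS hya
    exact ⟨negIndices_mem_signPatterns ⟨hzS, sign_eq_one_iff.1 hza⟩ hxs hzs,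
      negIndices_mem_signPatterns ⟨hwS, sign_eq_neg_one_iff.1 hwa⟩ hxs hws⟩

theorem ncard_signPatterns_insert [DecidableEq ι] (ha : a ∉ s) (hyS : y ∈ S) (hya : l a y ≠ 0) :
    (signPatterns l (insert a s) S).ncard = (signPatterns l s S).ncard +
      (signPatterns l s (S ⊓ zeroLocus (l a) : AffineSubspace 𝕜 E)).ncard := by
  rw [ncard_signPatterns_insert_eq_pos_add_neg ha,
    ← Set.ncard_union_add_ncard_inter _ _ (finite_signPatterns ..) (finite_signPatterns ..),
    signPatterns_pos_union_neg hyS hya, signPatterns_pos_inter_neg hyS hya]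

end Insert

theorem eval_whitneyPolynomial_neg_one [FiniteDimensional 𝕜 E] (l : ι → E →ᵃ[𝕜] 𝕜) (s : Finset ι)
    (S : AffineSubspace 𝕜 E) :
    (whitneyPolynomial (fun i => zeroLocus (l i)) s S).eval (-1) =
      (-1) ^ finrank 𝕜 S.direction * ((signPatterns l s S).ncard : ℤ) := by
  classical
  induction s using Finset.induction_on generalizing S with
  | empty =>
    rw [whitneyPolynomial, powerset_empty, sum_singleton, inf_empty, inf_top_eq]
    split_ifs with hS
    · simp [ncard_signPatterns_empty hS]
    · simp [signPatterns_of_eq_empty (Set.not_nonempty_iff_eq_empty.1 hS)]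
  | insert a s ha ih =>
    rw [whitneyPolynomial_insert _ _ ha, Polynomial.eval_sub, ih, ih]
    by_cases hS : S ≤ zeroLocus (l a)
    · have hempty : signPatterns l (insert a s) (S : Set E) = ∅ := by
        refine Set.eq_empty_of_forall_notMem ?_
        rintro _ ⟨x, ⟨hxS, hx⟩, -⟩
        exact hx a (mem_insert_self a s) (hS hxS)
      rw [inf_eq_left.2 hS, hempty, sub_self, Set.ncard_empty, Nat.cast_zero, mul_zero]
    · obtain ⟨y, hyS, hya⟩ := SetLike.not_le_iff_exists.1 hS
      rw [ncard_signPatterns_insert ha hyS hya,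
        neg_one_pow_finrank_mul_ncard_signPatterns_inf_zeroLocus hyS hya]
      push_cast
      ring

end SignPatterns

section Regions

open SignType

theorem nonempty_equiv_image_of_eq_iff_eq {α β γ : Type*} {f : α → β} {g : α → γ} {s : Set α}
    (h : ∀ x ∈ s, ∀ y ∈ s, f x = f y ↔ g x = g y) : Nonempty (f '' s ≃ g '' s) := by
  have hker : Setoid.ker (s.domRestrict f) = Setoid.ker (s.domRestrict g) :=
    Setoid.ext fun x y => h x x.2 y y.2
  rw [← Set.range_domRestrict, ← Set.range_domRestrict]
  exact ⟨(Setoid.quotientKerEquivRange _).symm.trans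
    ((Quotient.congrRight fun x y => by rw [hker]).trans
      (Setoid.quotientKerEquivRange _))⟩

theorem sign_eq_of_isPreconnected {X : Type*} [TopologicalSpace X] {U : Set X} {f : X → ℝ}
    (hU : IsPreconnected U) (hf : ContinuousOn f U) (h0 : ∀ x ∈ U, f x ≠ 0) {x y : X} (hx : x ∈ U)
    (hy : y ∈ U) : sign (f x) = sign (f y) :=
  hU.constant (f := fun z => sign (f z)) (fun z hz =>
    (continuousAt_sign_of_ne_zero (h0 z hz)).comp_continuousWithinAt (hf z hz)) hx hy

variable {E ι : Type*} [NormedAddCommGroup E] [NormedSpace ℝ E] {l : ι → E →ᵃ[ℝ] ℝ}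

theorem mem_compl_iUnion_zeroLocus {x : E} :
    x ∈ (⋃ H ∈ Set.range fun i => zeroLocus (l i), (H : Set E))ᶜ ↔ ∀ i, l i x ≠ 0 := by
  simp

theorem connectedComponentIn_compl_iUnion_zeroLocus (hl : ∀ i, Continuous (l i)) {x : E}
    (hx : ∀ i, l i x ≠ 0) :
    connectedComponentIn (⋃ H ∈ Set.range fun i => zeroLocus (l i), (H : Set E))ᶜ x =
      {y | ∀ i, sign (l i y) = sign (l i x)} := by
  have hxU := mem_compl_iUnion_zeroLocus.2 hx
  refine Set.Subset.antisymm (fun y hy i => ?_) ?_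
  · exact sign_eq_of_isPreconnected isPreconnected_connectedComponentIn (hl i).continuousOn
      (fun z hz => mem_compl_iUnion_zeroLocus.1 (connectedComponentIn_subset _ _ hz) i) hy
      (mem_connectedComponentIn hxU)
  · refine IsPreconnected.subset_connectedComponentIn ?_ (fun i => rfl) fun y hy =>
      mem_compl_iUnion_zeroLocus.2 fun i => sign_ne_zero.1 (hy i ▸ sign_ne_zero.2 (hx i))
    rw [Set.ofPred_forall]
    exact (convex_iInter fun i =>
      (convex_setOf_sign_eq (sign (l i x))).affine_preimage (l i)).isPreconnected

theorem nonempty_equiv_regions_signPatterns [Fintype ι] (hl : ∀ i, Continuous (l i)) :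
    Nonempty (regions (Set.range fun i => zeroLocus (l i)) ≃
      signPatterns l Finset.univ Set.univ) := by
  set U : Set E := (⋃ H ∈ Set.range fun i => zeroLocus (l i), (H : Set E))ᶜ with hU
  have hregions : regions (Set.range fun i => zeroLocus (l i)) = connectedComponentIn U '' U :=
    Set.ext fun R => exists_congr fun x => and_congr_right fun _ => eq_comm
  have hpatterns : signPatterns l Finset.univ Set.univ = negIndices l Finset.univ '' U := by
    simp only [signPatterns, Finset.mem_univ, forall_const, Set.mem_univ, true_and]
    congr 1
    ext x
    exact mem_compl_iUnion_zeroLocus.symm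
  rw [hregions, hpatterns]
  refine nonempty_equiv_image_of_eq_iff_eq fun x hx y hy => ?_
  rw [hU, mem_compl_iUnion_zeroLocus] at hx hy
  rw [connectedComponentIn_compl_iUnion_zeroLocus hl hx,
    connectedComponentIn_compl_iUnion_zeroLocus hl hy]
  constructor
  · intro h
    have hxy : ∀ i, sign (l i x) = sign (l i y) := h.subset fun i => rfl
    exact negIndices_congr fun i _ => hxy i
  · intro h
    have hxy (i : ι) : sign (l i x) = sign (l i y) :=
      sign_eq_of_negIndices_eq (fun i _ => hx i) (fun i _ => hy i) h (Finset.mem_univ i)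
    simp only [hxy]

theorem finite_regions [Finite ι] (hl : ∀ i, Continuous (l i)) :
    (regions (Set.range fun i => zeroLocus (l i))).Finite := by
  have := Fintype.ofFinite ι
  obtain ⟨e⟩ := nonempty_equiv_regions_signPatterns hl
  exact e.set_finite_iff.2 (finite_signPatterns ..)

theorem ncard_regions [Fintype ι] (hl : ∀ i, Continuous (l i)) :
    (regions (Set.range fun i => zeroLocus (l i))).ncard =
      (signPatterns l Finset.univ Set.univ).ncard := by
  obtain ⟨e⟩ := nonempty_equiv_regions_signPatterns hl
  exact Nat.card_congr e

theorem ncard_regions_eq_eval_characteristicPolynomial [FiniteDimensional ℝ E] [Finite ι]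
    (hl : ∀ i, zeroLocus (l i) ≠ ⊤) (hA : (Set.range fun i => zeroLocus (l i)).Finite) :
    ((regions (Set.range fun i => zeroLocus (l i))).ncard : ℤ) =
      (-1) ^ finrank ℝ E *
        (characteristicPolynomial (Set.range fun i => zeroLocus (l i)) hA).eval (-1) := by
  have := Fintype.ofFinite ι
  rw [ncard_regions fun i => (l i).continuous_of_finiteDimensional,
    characteristicPolynomial_range hl, eval_whitneyPolynomial_neg_one,
    AffineSubspace.direction_top, finrank_top, ← mul_assoc, ← mul_pow, neg_one_mul, neg_neg,
    one_pow, one_mul]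
  rfl

end Regions

/-! ### Facets and visibility of polyhedra -/

section Polyhedron

open SignType

theorem affineSpan_eq_of_forall_exists_lineMap_mem {𝕜 E : Type*} [Field 𝕜] [AddCommGroup E]
    [Module 𝕜 E] {S : AffineSubspace 𝕜 E} {F : Set E} {x : E} (hF : F ⊆ S) (hx : x ∈ F)
    (h : ∀ y ∈ S, ∃ t : 𝕜, t ≠ 0 ∧ AffineMap.lineMap x y t ∈ F) : affineSpan 𝕜 F = S := by
  refine le_antisymm (affineSpan_le.2 hF) fun y hy => ?_
  obtain ⟨t, ht, hz⟩ := h y hy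
  have hline := AffineMap.lineMap_mem t⁻¹ (subset_affineSpan 𝕜 F hx) (subset_affineSpan 𝕜 F hz)
  rwa [AffineMap.lineMap_lineMap_right, inv_mul_cancel₀ ht, AffineMap.lineMap_apply_one] at hline

variable {𝕜 E ι : Type*} [Field 𝕜] [LinearOrder 𝕜] [AddCommGroup E] [Module 𝕜 E]

/-- The polyhedron of the points at which all the given affine functionals are nonnegative. -/
def polyhedron (l : ι → E →ᵃ[𝕜] 𝕜) : Set E :=
  {x | ∀ i, 0 ≤ l i x}

/-- The face of `polyhedron l` on which the `i`-th inequality is an equality. -/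
def polyhedronFace (l : ι → E →ᵃ[𝕜] 𝕜) (i : ι) : Set E :=
  {x ∈ polyhedron l | l i x = 0}

/-- An irredundant description of a full-dimensional polyhedron: all the inequalities are strict at
some point, and each of them is an equality at some point where all the others are strict. -/
structure IsIrredundant (l : ι → E →ᵃ[𝕜] 𝕜) : Prop where
  exists_forall_pos : ∃ x, ∀ i, 0 < l i x
  exists_eq_zero_and_forall_pos : ∀ i, ∃ x, l i x = 0 ∧ ∀ j ≠ i, 0 < l j x

variable {l : ι → E →ᵃ[𝕜] 𝕜} {i : ι} {x y : E}

theorem mem_polyhedronFace_of_eq_zero_of_forall_pos (hi : l i x = 0) (h : ∀ j ≠ i, 0 < l j x) :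
    x ∈ polyhedronFace l i := by
  refine ⟨fun j => ?_, hi⟩
  rcases eq_or_ne j i with rfl | hj
  exacts [hi.ge, (h j hj).le]

theorem IsIrredundant.polyhedronFace_injective (hl : IsIrredundant l) :
    Function.Injective (polyhedronFace l) := by
  intro i j h
  by_contra hij
  obtain ⟨w, hwi, hw⟩ := hl.exists_eq_zero_and_forall_pos i
  have hmem : w ∈ polyhedronFace l j := h ▸ mem_polyhedronFace_of_eq_zero_of_forall_pos hwi hw
  exact (hw j (Ne.symm hij)).ne' hmem.2

theorem IsIrredundant.zeroLocus_ne_top (hl : IsIrredundant l) (i : ι) : zeroLocus (l i) ≠ ⊤ := by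
  obtain ⟨x, hx⟩ := hl.exists_forall_pos
  exact _root_.zeroLocus_ne_top (hx i).ne'

variable [IsStrictOrderedRing 𝕜]

theorem convex_polyhedron (l : ι → E →ᵃ[𝕜] 𝕜) : Convex 𝕜 (polyhedron l) := by
  rw [polyhedron, Set.ofPred_forall]
  exact convex_iInter fun i => (convex_Ici 0).affine_preimage (l i)

theorem exists_mem_forall_pos_of_convex {F : Set E} (hF : Convex 𝕜 F) (hne : F.Nonempty)
    (hFl : F ⊆ polyhedron l) (h : ∀ i, ∃ x ∈ F, l i x ≠ 0) (s : Finset ι) :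
    ∃ x ∈ F, ∀ i ∈ s, 0 < l i x := by
  classical
  induction s using Finset.induction_on with
  | empty => exact ⟨hne.some, hne.some_mem, by simp⟩
  | insert a s _ ih =>
    obtain ⟨x, hx, hxs⟩ := ih
    obtain ⟨y, hy, hya⟩ := h a
    refine ⟨midpoint 𝕜 x y, hF.midpoint_mem hx hy, fun i hi => ?_⟩
    have hsum : 0 < l i x + l i y := by
      rcases Finset.mem_insert.1 hi with rfl | hi
      · exact add_pos_of_nonneg_of_pos (hFl hx i) ((hFl hy i).lt_of_ne' hya)
      · exact add_pos_of_pos_of_nonneg (hxs i hi) (hFl hy i)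
    rw [AffineMap.map_midpoint, midpoint_eq_smul_add, smul_eq_mul]
    exact mul_pos (by simp) hsum

theorem range_negIndices [Fintype ι] (hy : ∀ i, 0 < l i y) :
    Set.range (negIndices l Finset.univ) = signPatterns l Finset.univ Set.univ := by
  refine Set.Subset.antisymm ?_ (Set.image_subset_range _ _)
  rintro _ ⟨x, rfl⟩
  obtain ⟨t, -, -, ht⟩ := exists_forall_sign_apply_lineMap_eq l Finset.univ x y
  refine ⟨AffineMap.lineMap x y t, ⟨trivial, fun i hi => ?_⟩, Finset.filter_congr fun i hi => ?_⟩
  · rw [← sign_ne_zero, ht i hi]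
    split_ifs with h
    exacts [sign_ne_zero.2 (hy i).ne', sign_ne_zero.2 h]
  · rw [← sign_eq_neg_one_iff, ht i hi]
    split_ifs with h
    · simp [h, sign_pos (hy i)]
    · exact sign_eq_neg_one_iff

variable [Finite ι]

theorem exists_lineMap_mem_polyhedron (hx : x ∈ polyhedron l) (hy : ∀ i, l i x = 0 → 0 ≤ l i y) :
    ∃ t : 𝕜, 0 < t ∧ t < 1 ∧ AffineMap.lineMap x y t ∈ polyhedron l := by
  have := Fintype.ofFinite ι
  obtain ⟨t, ht0, ht1, hsign⟩ := exists_forall_sign_apply_lineMap_eq l Finset.univ x y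
  refine ⟨t, ht0, ht1, fun i => ?_⟩
  rw [← sign_nonneg_iff, hsign i (Finset.mem_univ i)]
  split_ifs with h
  exacts [sign_nonneg_iff.2 (hy i h), sign_nonneg_iff.2 (hx i)]

theorem affineSpan_polyhedron (hx : ∀ i, 0 < l i x) : affineSpan 𝕜 (polyhedron l) = ⊤ := by
  have hxl : x ∈ polyhedron l := fun i => (hx i).le
  refine affineSpan_eq_of_forall_exists_lineMap_mem (Set.subset_univ _) hxl fun y _ => ?_
  obtain ⟨t, ht, -, hty⟩ :=
    exists_lineMap_mem_polyhedron (y := y) hxl fun i h => absurd h (hx i).ne'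
  exact ⟨t, ht.ne', hty⟩

theorem affineSpan_polyhedronFace (hi : l i x = 0) (h : ∀ j ≠ i, 0 < l j x) :
    affineSpan 𝕜 (polyhedronFace l i) = zeroLocus (l i) := by
  have hx := mem_polyhedronFace_of_eq_zero_of_forall_pos hi h
  refine affineSpan_eq_of_forall_exists_lineMap_mem (fun y hy => hy.2) hx fun y hy => ?_
  obtain ⟨t, ht, -, hty⟩ := exists_lineMap_mem_polyhedron (y := y) hx.1 fun j hj => by
    obtain rfl : j = i := by_contra fun hne => (h j hne).ne' hj
    exact (mem_zeroLocus.1 hy).ge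
  exact ⟨t, ht.ne', hty, AffineMap.lineMap_mem t (mem_zeroLocus.2 hi) hy⟩

theorem exists_forall_eq_zero_of_isExtreme {F : Set E} (hF : IsExtreme 𝕜 (polyhedron l) F)
    (hconv : Convex 𝕜 F) (hne : F.Nonempty) (hFl : F ≠ polyhedron l) :
    ∃ i, ∀ x ∈ F, l i x = 0 := by
  have := Fintype.ofFinite ι
  by_contra! h
  obtain ⟨x, hxF, hx⟩ := exists_mem_forall_pos_of_convex hconv hne hF.subset h Finset.univ
  refine hFl (hF.subset.antisymm fun y hy => ?_)
  obtain ⟨t, ht, -, hz⟩ := exists_lineMap_mem_polyhedron (y := AffineMap.lineMap y x (2 : 𝕜))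
    (hF.subset hxF) fun i hi => absurd hi (hx i (Finset.mem_univ i)).ne'
  refine hF.left_mem_of_mem_openSegment hy hz hxF
    ⟨t / (1 + t), 1 / (1 + t), by positivity, by positivity, by field_simp; ring, ?_⟩
  simp only [AffineMap.lineMap_apply_module]
  match_scalars <;> field_simp <;> ring

end Polyhedron

section Facets

theorem eq_inter_affineSpan_of_isExposed {𝕜 E : Type*} [Ring 𝕜] [PartialOrder 𝕜]
    [TopologicalSpace 𝕜] [AddCommGroup E] [TopologicalSpace E] [Module 𝕜 E] {K F : Set E}
    (hF : IsExposed 𝕜 K F) (hne : F.Nonempty) : F = K ∩ affineSpan 𝕜 F := by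
  refine Set.Subset.antisymm (fun x hx => ⟨hF.subset hx, subset_affineSpan 𝕜 F hx⟩) ?_
  obtain ⟨g, hg⟩ := hF hne
  obtain ⟨x, hx⟩ := hne
  have hconst : ∀ y ∈ affineSpan 𝕜 F, g y = g x := fun y hy => by
    refine affineSpan_induction (p := fun y => g y = g x) hy (fun z hz => ?_) ?_
    · rw [hg] at hx hz
      exact le_antisymm (hx.2 z hz.1) (hz.2 x hx.1)
    · intro c u v w hu hv hw
      simp only [vsub_eq_sub, vadd_eq_add, map_add, map_smul, map_sub, hu, hv, hw, sub_self,
        smul_zero, zero_add]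
  rintro y ⟨hyK, hy⟩
  rw [hg] at hx ⊢
  exact ⟨hyK, fun z hz => (hx.2 z hz).trans (hconst y hy).ge⟩

variable {E ι : Type*} [NormedAddCommGroup E] [NormedSpace ℝ E] [FiniteDimensional ℝ E]
  {l : ι → E →ᵃ[ℝ] ℝ}

theorem isExposed_polyhedronFace {i : ι} (hne : (polyhedronFace l i).Nonempty) :
    IsExposed ℝ (polyhedron l) (polyhedronFace l i) := by
  obtain ⟨w, hwl, hw⟩ := hne
  refine fun _ => ⟨-LinearMap.toContinuousLinearMap (l i).linear, Set.ext fun x =>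
    and_congr_right fun hx => ?_⟩
  have hle (y : E) : (l i).linear x ≤ (l i).linear y ↔ l i x ≤ l i y := by
    rw [← sub_nonneg, ← map_sub, ← vsub_eq_sub, AffineMap.linearMap_vsub, vsub_eq_sub, sub_nonneg]
  simp only [neg_apply, LinearMap.coe_toContinuousLinearMap', neg_le_neg_iff, hle]
  exact ⟨fun h y hy => h.trans_le (hy i), fun h => ((h w hwl).trans_eq hw).antisymm (hx i)⟩

theorem IsIrredundant.facets_polyhedron [Finite ι] (hl : IsIrredundant l) :
    facets (polyhedron l) = Set.range (polyhedronFace l) := by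
  obtain ⟨p, hp⟩ := hl.exists_forall_pos
  have hK : finrank ℝ (affineSpan ℝ (polyhedron l)).direction = finrank ℝ E := by
    rw [affineSpan_polyhedron hp, AffineSubspace.direction_top, finrank_top]
  have hdim (i : ι) : finrank ℝ (zeroLocus (l i)).direction + 1 = finrank ℝ E := by
    obtain ⟨w, hwi, -⟩ := hl.exists_eq_zero_and_forall_pos i
    have := finrank_direction_inf_zeroLocus_add_one (AffineSubspace.mem_top ℝ E w) hwi
      (AffineSubspace.mem_top ℝ E p) (hp i).ne'
    rwa [top_inf_eq, AffineSubspace.direction_top, finrank_top] at this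
  refine Set.Subset.antisymm ?_ ?_
  · rintro F ⟨hF, hne, hfinrank⟩
    rw [hK] at hfinrank
    have hFl : F ≠ polyhedron l := by
      rintro rfl
      omega
    obtain ⟨i, hi⟩ := exists_forall_eq_zero_of_isExtreme hF.isExtreme
      (hF.convex (convex_polyhedron l)) hne hFl
    have hle : affineSpan ℝ F ≤ zeroLocus (l i) := affineSpan_le.2 hi
    have hspan : affineSpan ℝ F = zeroLocus (l i) :=
      AffineSubspace.eq_of_direction_eq_of_nonempty_of_le
        (Submodule.eq_of_le_of_finrank_eq (AffineSubspace.direction_le hle)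
          (by have := hdim i; omega)) (hne.affineSpan ℝ) hle
    exact ⟨i, ((eq_inter_affineSpan_of_isExposed hF hne).trans (by rw [hspan]; rfl)).symm⟩
  · rintro _ ⟨i, rfl⟩
    obtain ⟨w, hwi, hw⟩ := hl.exists_eq_zero_and_forall_pos i
    have hne : (polyhedronFace l i).Nonempty :=
      ⟨w, mem_polyhedronFace_of_eq_zero_of_forall_pos hwi hw⟩
    refine ⟨isExposed_polyhedronFace hne, hne, ?_⟩
    rw [affineSpan_polyhedronFace hwi hw, hK, hdim i]

theorem IsIrredundant.visibilityArrangement_polyhedron [Finite ι] (hl : IsIrredundant l) :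
    visibilityArrangement (polyhedron l) = Set.range fun i => zeroLocus (l i) := by
  rw [visibilityArrangement, hl.facets_polyhedron, ← Set.range_comp]
  congr 1
  funext i
  obtain ⟨w, hwi, hw⟩ := hl.exists_eq_zero_and_forall_pos i
  exact affineSpan_polyhedronFace hwi hw

theorem IsIrredundant.visibleFacets_polyhedron [Fintype ι] (hl : IsIrredundant l) (x : E) :
    visibleFacets (polyhedron l) x = polyhedronFace l '' negIndices l Finset.univ x := by
  ext F
  rw [visibleFacets, hl.facets_polyhedron]
  constructor
  · rintro ⟨⟨i, rfl⟩, hx, hvis⟩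
    refine ⟨i, mem_negIndices.2 ⟨Finset.mem_univ i, ?_⟩, rfl⟩
    by_contra! hxi
    obtain ⟨w, hwi, hw⟩ := hl.exists_eq_zero_and_forall_pos i
    have hwF := mem_polyhedronFace_of_eq_zero_of_forall_pos hwi hw
    obtain ⟨t, ht0, ht1, ht⟩ := exists_lineMap_mem_polyhedron (y := x) hwF.1 fun j hj => by
      obtain rfl : j = i := by_contra fun hne => (hw j hne).ne' hj
      exact hxi
    have hwx : w ≠ x := fun h => hx (h ▸ hwF.1)
    exact hvis w hwF ht (sbtw_comm.1 (sbtw_lineMap_iff.2 ⟨hwx, ht0, ht1⟩))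
  · rintro ⟨i, hi, rfl⟩
    have hxi : l i x < 0 := (mem_negIndices.1 hi).2
    refine ⟨⟨i, rfl⟩, fun hx => (hx i).not_gt hxi, fun y hy z hz hs => ?_⟩
    obtain ⟨t, ⟨-, ht1⟩, rfl⟩ := hs.mem_image_Ioo
    have hlz := hz i
    rw [AffineMap.apply_lineMap, hy.2, AffineMap.lineMap_apply_ring, mul_zero, add_zero] at hlz
    exact hlz.not_gt (mul_neg_of_pos_of_neg (sub_pos.2 ht1) hxi)

theorem IsIrredundant.ncard_visibilitySets_polyhedron [Fintype ι] (hl : IsIrredundant l) :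
    (visibilitySets (polyhedron l)).ncard = (signPatterns l Finset.univ Set.univ).ncard := by
  have hcomp : visibleFacets (polyhedron l) =
      (fun N : Finset ι => polyhedronFace l '' N) ∘ negIndices l Finset.univ :=
    funext hl.visibleFacets_polyhedron
  obtain ⟨p, hp⟩ := hl.exists_forall_pos
  rw [visibilitySets, hcomp, Set.range_comp, range_negIndices hp, Set.ncard_image_of_injective]
  exact hl.polyhedronFace_injective.image_injective.comp Finset.coe_injective

end Facets

/-! ### The finite field method -/

section CompatibleMaps

variable {V β D : Type*} {r : V ⊕ β → V ⊕ β → Prop} {k : β → D} {x y : V → D}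

/-- The maps `V → D` which, together with the boundary values `k` on `β`, satisfy the equation
between the values at `a` and at `b` whenever `r a b`. -/
def compatibleMaps (r : V ⊕ β → V ⊕ β → Prop) (k : β → D) : Set (V → D) :=
  {x | ∀ a b, r a b → Sum.elim x k a = Sum.elim x k b}

/-- The classes of `V ⊕ β` under the equivalence relation generated by `r` that contain no boundary
element; a compatible map has an arbitrary value on each of them and is determined by these values.
-/
def FreeClass (r : V ⊕ β → V ⊕ β → Prop) : Type _ :=
  {c : Quot r // c ∉ Set.range fun b => Quot.mk r (Sum.inr b)}

theorem sumElim_eq_of_mk_eq (hx : x ∈ compatibleMaps r k) {a b : V ⊕ β}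
    (h : Quot.mk r a = Quot.mk r b) : Sum.elim x k a = Sum.elim x k b :=
  congrArg (Quot.lift (Sum.elim x k) hx) h

theorem mem_compatibleMaps_of_sumElim_eq {z : Quot r → D}
    (h : ∀ a, Sum.elim x k a = z (Quot.mk r a)) : x ∈ compatibleMaps r k := fun a b hab => by
  rw [h, h, Quot.sound hab]

theorem mem_compatibleMaps_image {ι : Type*} {e : ι → (V ⊕ β) × (V ⊕ β)} {B : Finset ι} :
    x ∈ compatibleMaps (fun a b => ∃ i ∈ B, e i = (a, b)) k ↔
      ∀ i ∈ B, Sum.elim x k (e i).1 = Sum.elim x k (e i).2 := by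
  refine ⟨fun h i hi => h _ _ ⟨i, hi, rfl⟩, ?_⟩
  rintro h a b ⟨i, hi, hab⟩
  simpa only [hab] using h i hi

theorem exists_forall_mk_inl_eq (r : V ⊕ β → V ⊕ β → Prop) :
    ∃ ρ : FreeClass r → V, ∀ c, Quot.mk r (Sum.inl (ρ c)) = c.1 := by
  suffices h : ∀ c : FreeClass r, ∃ v, Quot.mk r (Sum.inl v) = c.1 from
    ⟨fun c => (h c).choose, fun c => (h c).choose_spec⟩
  rintro ⟨c, hc⟩
  induction c using Quot.ind with
  | mk a =>
    rcases a with v | b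
    exacts [⟨v, rfl⟩, absurd ⟨b, rfl⟩ hc]

theorem bijOn_comp_compatibleMaps {ρ : FreeClass r → V}
    (hρ : ∀ c, Quot.mk r (Sum.inl (ρ c)) = c.1) (k : β → D)
    (hr : Function.Injective fun b => Quot.mk r (Sum.inr b)) :
    Set.BijOn (fun x => x ∘ ρ) (compatibleMaps r k) Set.univ := by
  classical
  refine ⟨Set.mapsTo_univ _ _, fun x hx y hy hxy => funext fun v => ?_, fun y _ => ?_⟩
  · by_cases hv : Quot.mk r (Sum.inl v) ∈ Set.range fun b => Quot.mk r (Sum.inr b)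
    · obtain ⟨b, hb⟩ := hv
      exact (sumElim_eq_of_mk_eq hx hb).symm.trans (sumElim_eq_of_mk_eq hy hb)
    · exact (sumElim_eq_of_mk_eq hx (hρ ⟨_, hv⟩)).symm.trans
        ((congrFun hxy ⟨_, hv⟩).trans (sumElim_eq_of_mk_eq hy (hρ ⟨_, hv⟩)))
  · let z (c : Quot r) : D :=
      if h : c ∈ Set.range fun b => Quot.mk r (Sum.inr b) then k h.choose else y ⟨c, h⟩
    have hz (b : β) : z (Quot.mk r (Sum.inr b)) = k b := by
      have hb : Quot.mk r (Sum.inr b) ∈ Set.range fun b => Quot.mk r (Sum.inr b) := ⟨b, rfl⟩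
      exact (dif_pos hb).trans (congrArg k (hr hb.choose_spec))
    refine ⟨fun v => z (Quot.mk r (Sum.inl v)), mem_compatibleMaps_of_sumElim_eq (z := z) ?_,
      funext fun c => ?_⟩
    · rintro (v | b)
      exacts [rfl, (hz b).symm]
    · exact (congrArg z (hρ c)).trans (dif_neg c.2)

theorem natCard_compatibleMaps [Finite V] [Finite β] (k : β → D)
    (hr : Function.Injective fun b => Quot.mk r (Sum.inr b)) :
    Nat.card (compatibleMaps r k) = Nat.card D ^ Nat.card (FreeClass r) := by
  obtain ⟨ρ, hρ⟩ := exists_forall_mk_inl_eq r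
  have : Finite (FreeClass r) := Subtype.finite
  rw [Nat.card_congr (bijOn_comp_compatibleMaps hρ k hr).equiv, Nat.card_congr (Equiv.Set.univ _),
    Nat.card_fun]

theorem injective_mk_inr_of_mem_compatibleMaps (hk : Function.Injective k)
    (hx : x ∈ compatibleMaps r k) : Function.Injective fun b => Quot.mk r (Sum.inr b) :=
  fun _ _ h => hk (sumElim_eq_of_mk_eq hx h)

variable {𝕜 : Type*} [Field 𝕜] {κ : β → 𝕜} {S : AffineSubspace 𝕜 (V → 𝕜)}

theorem mem_direction_iff_mem_compatibleMaps (hS : (S : Set (V → 𝕜)) = compatibleMaps r κ)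
    (hne : (S : Set (V → 𝕜)).Nonempty) {v : V → 𝕜} :
    v ∈ S.direction ↔ v ∈ compatibleMaps r (0 : β → 𝕜) := by
  obtain ⟨p, hp⟩ := hne
  have hadd (a : V ⊕ β) :
      Sum.elim (v +ᵥ p) κ a = Sum.elim v (0 : β → 𝕜) a + Sum.elim p κ a := by
    rcases a with a | b <;> simp
  rw [← AffineSubspace.vadd_mem_iff_mem_direction v hp, ← SetLike.mem_coe, hS]
  refine forall₃_congr fun a b hab => ?_
  rw [hadd, hadd, (hS ▸ hp : p ∈ compatibleMaps r κ) a b hab, add_left_inj]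

theorem finrank_direction_eq_natCard_freeClass [Finite V] [Finite β]
    (hS : (S : Set (V → 𝕜)) = compatibleMaps r κ) (hne : (S : Set (V → 𝕜)).Nonempty)
    (hr : Function.Injective fun b => Quot.mk r (Sum.inr b)) :
    finrank 𝕜 S.direction = Nat.card (FreeClass r) := by
  obtain ⟨ρ, hρ⟩ := exists_forall_mk_inl_eq r
  have : Finite (FreeClass r) := Subtype.finite
  have := Fintype.ofFinite (FreeClass r)
  have hdir : (S.direction : Set (V → 𝕜)) = compatibleMaps r 0 :=
    Set.ext fun v => mem_direction_iff_mem_compatibleMaps hS hne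
  have hbij := bijOn_comp_compatibleMaps hρ (0 : β → 𝕜) hr
  rw [← hdir] at hbij
  let f : S.direction →ₗ[𝕜] FreeClass r → 𝕜 := LinearMap.funLeft 𝕜 𝕜 ρ ∘ₗ S.direction.subtype
  have hf : Function.Bijective f := by
    refine ⟨hbij.injOn.injective, fun y => ?_⟩
    obtain ⟨v, hv, rfl⟩ := hbij.surjOn (Set.mem_univ y)
    exact ⟨⟨v, hv⟩, rfl⟩
  rw [(LinearEquiv.ofBijective f hf).finrank_eq, finrank_fintype_fun_eq_card,
    Nat.card_eq_fintype_card]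

theorem natCard_compatibleMaps_eq_ite [Finite V] [Finite β] (hk : Function.Injective k)
    (hκ : Function.Injective κ) (hS : (S : Set (V → 𝕜)) = compatibleMaps r κ)
    [Decidable (S : Set (V → 𝕜)).Nonempty] :
    Nat.card (compatibleMaps r k) =
      if (S : Set (V → 𝕜)).Nonempty then Nat.card D ^ finrank 𝕜 S.direction else 0 := by
  split_ifs with hne
  · obtain ⟨x, hx⟩ := hS ▸ hne
    have hr := injective_mk_inr_of_mem_compatibleMaps hκ hx
    rw [natCard_compatibleMaps k hr, finrank_direction_eq_natCard_freeClass hS hne hr]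
  · have : IsEmpty (compatibleMaps r k) := by
      refine ⟨fun x => hne ?_⟩
      have hr := injective_mk_inr_of_mem_compatibleMaps hk x.2
      obtain ⟨ρ, hρ⟩ := exists_forall_mk_inl_eq r
      obtain ⟨y, hy, -⟩ := (bijOn_comp_compatibleMaps hρ κ hr).surjOn (Set.mem_univ 0)
      exact hS ▸ ⟨y, hy⟩
    exact Nat.card_of_isEmpty

end CompatibleMaps

section FiniteFieldMethod

variable {𝕜 V β ι : Type*} [Field 𝕜]

/-- The affine functional on `V → 𝕜` that evaluates the extension of a vector by the boundary values
`κ` on `β`. -/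
def extendedCoord (κ : β → 𝕜) (a : V ⊕ β) : (V → 𝕜) →ᵃ[𝕜] 𝕜 :=
  Sum.elim (fun v => (LinearMap.proj v : (V → 𝕜) →ₗ[𝕜] 𝕜).toAffineMap)
    (fun b => AffineMap.const 𝕜 (V → 𝕜) (κ b)) a

@[simp]
theorem extendedCoord_apply (κ : β → 𝕜) (a : V ⊕ β) (x : V → 𝕜) :
    extendedCoord κ a x = Sum.elim x κ a := by
  rcases a with v | b <;> rfl

theorem mem_finset_inf_affineSubspace {E : Type*} [AddCommGroup E] [Module 𝕜 E]
    {H : ι → AffineSubspace 𝕜 E} {B : Finset ι} {x : E} : x ∈ B.inf H ↔ ∀ i ∈ B, x ∈ H i := by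
  simp only [Finset.inf_eq_iInf, AffineSubspace.mem_iInf_iff]

theorem coe_inf_zeroLocus_extendedCoord (κ : β → 𝕜) (e : ι → (V ⊕ β) × (V ⊕ β)) (B : Finset ι) :
    ((B.inf fun i => zeroLocus (extendedCoord κ (e i).2 - extendedCoord κ (e i).1) :
      AffineSubspace 𝕜 (V → 𝕜)) : Set (V → 𝕜)) =
      compatibleMaps (fun a b => ∃ i ∈ B, e i = (a, b)) κ := by
  ext x
  rw [mem_compatibleMaps_image, SetLike.mem_coe, mem_finset_inf_affineSubspace]
  refine forall₂_congr fun i _ => ?_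
  rw [mem_zeroLocus, AffineMap.coe_sub, Pi.sub_apply, sub_eq_zero, extendedCoord_apply,
    extendedCoord_apply, eq_comm]

/- If `κ` and `k` are injective, an intersection of the hyperplanes is nonempty over `𝕜` exactly if
the equations have a solution over `D`, and then there are `#D` to the power of its dimension
solutions: inclusion–exclusion over `D` is Whitney's sum. -/
theorem eval_whitneyPolynomial_natCard [Finite V] [Finite β] [Fintype ι] {D : Type*} [Finite D]
    (e : ι → (V ⊕ β) × (V ⊕ β)) {κ : β → 𝕜} (hκ : Function.Injective κ) {k : β → D}
    (hk : Function.Injective k) :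
    (whitneyPolynomial (fun i => zeroLocus (extendedCoord κ (e i).2 - extendedCoord κ (e i).1))
      Finset.univ ⊤).eval (Nat.card D : ℤ) =
      Nat.card {x : V → D // ∀ i, Sum.elim x k (e i).1 ≠ Sum.elim x k (e i).2} := by
  classical
  have := Fintype.ofFinite V
  have := Fintype.ofFinite D
  let Z (i : ι) : Finset (V → D) := {x | Sum.elim x k (e i).1 = Sum.elim x k (e i).2}
  have hZ (B : Finset ι) : (B.inf Z).card =
      Nat.card (compatibleMaps (fun a b => ∃ i ∈ B, e i = (a, b)) k) :=
    (Nat.subtype_card _ fun x => by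
      simp only [Z, Finset.mem_inf, Finset.mem_filter_univ, ← mem_compatibleMaps_image]).symm
  have hcompl : Nat.card {x : V → D // ∀ i, Sum.elim x k (e i).1 ≠ Sum.elim x k (e i).2} =
      (Finset.univ.inf fun i => (Z i)ᶜ).card :=
    Nat.subtype_card _ fun x => by simp [Finset.mem_inf, Z]
  rw [hcompl, Finset.inclusion_exclusion_card_inf_compl, whitneyPolynomial,
    Polynomial.eval_finsetSum]
  refine Finset.sum_congr rfl fun B _ => ?_
  rw [hZ, natCard_compatibleMaps_eq_ite hk hκ (coe_inf_zeroLocus_extendedCoord κ e B), top_inf_eq]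
  split_ifs <;> simp

end FiniteFieldMethod

/-! ### Colorings with two special colors -/

section ExtendColoring

variable {V C : Type*} {G : SimpleGraph V}

open Classical in
/-- The extension of a coloring of the subgraph induced on `W` to the whole graph, with values in
`C` enlarged by two special colors: outside `W` the special color differs from the one of the
proper two-coloring `t`. -/
noncomputable def extendColoring (t : G.Coloring Bool) (W : Finset V)
    (c : (G.induce (W : Set V)).Coloring C) : G.Coloring (C ⊕ Bool) :=
  SimpleGraph.Coloring.mk
    (fun v => if h : v ∈ W then Sum.inl (c ⟨v, h⟩) else Sum.inr (!t v)) fun {v w} hvw => by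
      by_cases hv : v ∈ W <;> by_cases hw : w ∈ W <;> simp only [hv, hw, dite_true, dite_false]
      · exact Sum.inl_injective.ne (c.valid (v := ⟨v, hv⟩) (w := ⟨w, hw⟩) hvw)
      · exact Sum.inl_ne_inr
      · exact Sum.inr_ne_inl
      · exact Sum.inr_injective.ne (Bool.not_injective.ne (t.valid hvw))

variable {t : G.Coloring Bool} {W : Finset V} {c : (G.induce (W : Set V)).Coloring C} {v : V}

theorem extendColoring_of_mem (hv : v ∈ W) : extendColoring t W c v = Sum.inl (c ⟨v, hv⟩) :=
  dif_pos hv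

theorem extendColoring_of_notMem (hv : v ∉ W) : extendColoring t W c v = Sum.inr (!t v) :=
  dif_neg hv

theorem isLeft_extendColoring : (extendColoring t W c v).isLeft ↔ v ∈ W := by
  by_cases hv : v ∈ W
  · simp [extendColoring_of_mem hv, hv]
  · simp [extendColoring_of_notMem hv, hv]

theorem extendColoring_ne_inr : extendColoring t W c v ≠ Sum.inr (t v) := by
  by_cases hv : v ∈ W
  · simp [extendColoring_of_mem hv]
  · simp [extendColoring_of_notMem hv]

theorem sigma_extendColoring_injective (t : G.Coloring Bool) :
    Function.Injective fun p : Σ W : Finset V, (G.induce (W : Set V)).Coloring C =>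
      extendColoring t p.1 p.2 := by
  rintro ⟨W, c⟩ ⟨W', c'⟩ (h : extendColoring t W c = extendColoring t W' c')
  obtain rfl : W = W' := Finset.ext fun v => by
    rw [← isLeft_extendColoring (t := t) (c := c), h, isLeft_extendColoring]
  refine congrArg (Sigma.mk W) (RelHom.ext fun v => Sum.inl_injective (β := Bool) ?_)
  rw [← extendColoring_of_mem (t := t) v.2, h, extendColoring_of_mem v.2]

theorem exists_extendColoring_eq [Finite V] {x : G.Coloring (C ⊕ Bool)}
    (hx : ∀ v, x v ≠ Sum.inr (t v)) :
    ∃ (W : Finset V) (c : (G.induce (W : Set V)).Coloring C), extendColoring t W c = x := by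
  classical
  have := Fintype.ofFinite V
  let W : Finset V := {v | (x v).isLeft}
  have hW {v : V} : v ∈ W ↔ (x v).isLeft := Finset.mem_filter_univ v
  let c : (G.induce (W : Set V)).Coloring C :=
    SimpleGraph.Coloring.mk (fun v => (x v.1).getLeft (hW.1 v.2)) fun {v w} hvw h =>
      x.valid hvw <| show x v.1 = x w.1 by
        rw [← Sum.inl_getLeft (x v.1) (hW.1 v.2), h, Sum.inl_getLeft]
  refine ⟨W, c, RelHom.ext fun v => ?_⟩
  by_cases hv : v ∈ W
  · exact (extendColoring_of_mem hv).trans (Sum.inl_getLeft _ _)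
  · obtain ⟨b, hb⟩ := Sum.isRight_iff.1 (Sum.not_isLeft.1 (mt hW.2 hv))
    have hbt : b ≠ t v := fun h => hx v (hb.trans (congrArg Sum.inr h))
    rw [extendColoring_of_notMem hv, hb, Bool.eq_not.2 hbt]

theorem natCard_coloring_ne_inr [Fintype V] [Finite C] (t : G.Coloring Bool) :
    Nat.card {x : G.Coloring (C ⊕ Bool) // ∀ v, x v ≠ Sum.inr (t v)} =
      ∑ W : Finset V, Nat.card ((G.induce (W : Set V)).Coloring C) := by
  have := Fintype.ofFinite C
  rw [← Nat.card_sigma]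
  refine (Nat.card_eq_of_bijective (fun p => ⟨extendColoring t p.1 p.2,
    fun v => extendColoring_ne_inr⟩) ⟨fun p p' h => ?_, ?_⟩).symm
  · exact sigma_extendColoring_injective t (congrArg Subtype.val h)
  · rintro ⟨x, hx⟩
    obtain ⟨W, c, rfl⟩ := exists_extendColoring_eq hx
    exact ⟨⟨W, c⟩, rfl⟩

end ExtendColoring

/-! ### Order polytopes of posets of rank one -/

section OrderPolytope

variable {P : Type*} [PartialOrder P]

namespace IsGradedOfRankOne

theorem isMin_of_lt (hP : IsGradedOfRankOne P) {a b : P} (hab : a < b) : IsMin a := by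
  refine fun c hca => by_contra fun hac => ?_
  have hca : c < a := lt_of_le_not_ge hca hac
  have hchain : IsChain (· ≤ ·) ({c, a, b} : Set P) := by
    refine (IsChain.singleton.insert ?_).insert ?_
    · rintro x rfl -
      exact Or.inl hab.le
    · rintro x (rfl | rfl) -
      exacts [Or.inl hca.le, Or.inl (hca.trans hab).le]
  obtain ⟨M, hM, hsub⟩ := hchain.exists_maxChain
  have hle := Set.ncard_le_ncard hsub (Set.finite_of_ncard_ne_zero (by simp [hP M hM]))
  rw [hP M hM, Set.ncard_eq_three.2 ⟨c, a, b, hca.ne, (hca.trans hab).ne, hab.ne, rfl⟩] at hle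
  omega

theorem exists_lt_or_gt (hP : IsGradedOfRankOne P) (v : P) : ∃ u, u < v ∨ v < u := by
  obtain ⟨M, hM, hsub⟩ := (IsChain.singleton (r := (· ≤ ·)) (a := v)).exists_maxChain
  obtain ⟨u, hu, huv⟩ := Set.exists_ne_of_one_lt_ncard (s := M) (by simp [hP M hM]) v
  exact ⟨u, (hM.1 hu (hsub rfl) huv).imp (·.lt_of_ne huv) (·.lt_of_ne huv.symm)⟩

theorem hasse_adj (hP : IsGradedOfRankOne P) {a b : P} :
    (SimpleGraph.hasse P).Adj a b ↔ a < b ∨ b < a := by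
  have hcov {a b : P} : a ⋖ b ↔ a < b :=
    ⟨CovBy.lt, fun h => ⟨h, fun _ hac hcb => not_isMin_of_lt hac (hP.isMin_of_lt hcb)⟩⟩
  rw [SimpleGraph.hasse_adj, hcov, hcov]

open Classical in
/-- The two-coloring of the Hasse diagram by rank: `false` on the minimal elements and `true` on the
others. -/
noncomputable def rankColoring (hP : IsGradedOfRankOne P) : (SimpleGraph.hasse P).Coloring Bool :=
  SimpleGraph.Coloring.mk (fun v => decide (¬ IsMin v)) fun {a b} hab => by
    rcases hP.hasse_adj.1 hab with h | h <;> simp [hP.isMin_of_lt h, not_isMin_of_lt h]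

open Classical in
theorem rankColoring_apply (hP : IsGradedOfRankOne P) (v : P) :
    hP.rankColoring v = decide (¬ IsMin v) :=
  rfl

end IsGradedOfRankOne

/-- The inequalities of the order polytope of a poset of rank one: one for each comparable pair, and
one for each element, bounding it below by `0` if it is minimal and above by `1` otherwise. -/
abbrev OrderPolytopeIndex (P : Type*) [PartialOrder P] : Type _ :=
  {c : P × P // c.1 < c.2} ⊕ P

open Classical in
/-- The pair `(a, b)` such that the given inequality reads `x a ≤ x b`, where `false` and `true` are
formal elements at which every `x` has the value `0` and `1`, respectively. -/
noncomputable def orderPolytopeRelation : OrderPolytopeIndex P → (P ⊕ Bool) × (P ⊕ Bool)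
  | Sum.inl c => (Sum.inl c.1.1, Sum.inl c.1.2)
  | Sum.inr v => if IsMin v then (Sum.inr false, Sum.inl v) else (Sum.inl v, Sum.inr true)

/-- The affine functionals whose nonnegativity defines the order polytope of a poset of rank one. -/
noncomputable def orderPolytopeFunctional (i : OrderPolytopeIndex P) : (P → ℝ) →ᵃ[ℝ] ℝ :=
  extendedCoord (fun b : Bool => if b then (1 : ℝ) else 0) (orderPolytopeRelation i).2 -
    extendedCoord (fun b : Bool => if b then (1 : ℝ) else 0) (orderPolytopeRelation i).1

theorem orderPolytopeFunctional_inl (c : {c : P × P // c.1 < c.2}) (x : P → ℝ) :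
    orderPolytopeFunctional (Sum.inl c) x = x c.1.2 - x c.1.1 := by
  simp [orderPolytopeFunctional, orderPolytopeRelation]

theorem orderPolytopeFunctional_inr_of_isMin {v : P} (hv : IsMin v) (x : P → ℝ) :
    orderPolytopeFunctional (Sum.inr v) x = x v := by
  simp [orderPolytopeFunctional, orderPolytopeRelation, hv]

theorem orderPolytopeFunctional_inr_of_not_isMin {v : P} (hv : ¬ IsMin v) (x : P → ℝ) :
    orderPolytopeFunctional (Sum.inr v) x = 1 - x v := by
  simp [orderPolytopeFunctional, orderPolytopeRelation, hv]

theorem mem_polyhedron_orderPolytopeFunctional {x : P → ℝ} :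
    x ∈ polyhedron orderPolytopeFunctional ↔
      (∀ a b, a < b → x a ≤ x b) ∧ ∀ v, (IsMin v → 0 ≤ x v) ∧ (¬ IsMin v → x v ≤ 1) := by
  have hpair (c : {c : P × P // c.1 < c.2}) :
      0 ≤ orderPolytopeFunctional (Sum.inl c) x ↔ x c.1.1 ≤ x c.1.2 := by
    rw [orderPolytopeFunctional_inl, sub_nonneg]
  have hbound (v : P) : 0 ≤ orderPolytopeFunctional (Sum.inr v) x ↔
      (IsMin v → 0 ≤ x v) ∧ (¬ IsMin v → x v ≤ 1) := by
    by_cases hv : IsMin v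
    · simp [orderPolytopeFunctional_inr_of_isMin, hv]
    · simp [orderPolytopeFunctional_inr_of_not_isMin, hv]
  rw [polyhedron, Set.mem_ofPred_eq, Sum.forall, Subtype.forall, Prod.forall]
  exact and_congr (forall₃_congr fun _ _ _ => hpair _) (forall_congr' hbound)

theorem IsGradedOfRankOne.polyhedron_orderPolytopeFunctional (hP : IsGradedOfRankOne P) :
    polyhedron (orderPolytopeFunctional (P := P)) = orderPolytope P := by
  refine Set.ext fun x => mem_polyhedron_orderPolytopeFunctional.trans ⟨?_, ?_⟩
  · rintro ⟨hlt, hbound⟩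
    refine ⟨monotone_iff_forall_lt.2 fun a b => hlt a b, fun v => ?_⟩
    obtain ⟨u, hu | hu⟩ := hP.exists_lt_or_gt v
    · exact ⟨((hbound u).1 (hP.isMin_of_lt hu)).trans (hlt u v hu),
        (hbound v).2 (not_isMin_of_lt hu)⟩
    · exact ⟨(hbound v).1 (hP.isMin_of_lt hu),
        (hlt v u hu).trans ((hbound u).2 (not_isMin_of_lt hu))⟩
  · rintro ⟨hmono, hx⟩
    exact ⟨fun a b hab => hmono hab.le, fun v => ⟨fun _ => (hx v).1, fun _ => (hx v).2⟩⟩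

open Classical in
/-- A point in the interior of the order polytope of a poset of rank one. -/
noncomputable def orderPolytopeCenter (P : Type*) [PartialOrder P] (v : P) : ℝ :=
  if IsMin v then 1 / 3 else 2 / 3

open Classical in
/-- A point in the relative interior of a facet of the order polytope of a poset of rank one: the
interior point `orderPolytopeCenter P`, moved to the hyperplane of the given inequality. -/
noncomputable def orderPolytopeFacetPoint : OrderPolytopeIndex P → P → ℝ
  | Sum.inl c => fun v => if v = c.1.1 ∨ v = c.1.2 then 1 / 2 else orderPolytopeCenter P v
  | Sum.inr u => fun v => if v = u then (if IsMin v then 0 else 1) else orderPolytopeCenter P v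

theorem orderPolytopeFunctional_facetPoint (i : OrderPolytopeIndex P) :
    orderPolytopeFunctional i (orderPolytopeFacetPoint i) = 0 := by
  rcases i with c | v
  · simp [orderPolytopeFunctional_inl, orderPolytopeFacetPoint]
  · by_cases hv : IsMin v
    · simp [orderPolytopeFunctional_inr_of_isMin hv, orderPolytopeFacetPoint, hv]
    · simp [orderPolytopeFunctional_inr_of_not_isMin hv, orderPolytopeFacetPoint, hv]

theorem orderPolytopeFunctional_inr_facetPoint_pos {i : OrderPolytopeIndex P} {v : P}
    (hi : Sum.inr v ≠ i) : 0 < orderPolytopeFunctional (Sum.inr v) (orderPolytopeFacetPoint i) := by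
  have hpoint : orderPolytopeFacetPoint i v = 1 / 2 ∨
      orderPolytopeFacetPoint i v = orderPolytopeCenter P v := by
    rcases i with c | u
    · classical exact ite_eq_or_eq _ _ _
    · exact Or.inr (if_neg fun h => hi (congrArg Sum.inr h))
  by_cases hv : IsMin v
  · rw [orderPolytopeFunctional_inr_of_isMin hv]
    rcases hpoint with h | h <;> norm_num [h, orderPolytopeCenter, hv]
  · rw [orderPolytopeFunctional_inr_of_not_isMin hv]
    rcases hpoint with h | h <;> norm_num [h, orderPolytopeCenter, hv]

namespace IsGradedOfRankOne

theorem orderPolytopeFunctional_center_pos (hP : IsGradedOfRankOne P) (i : OrderPolytopeIndex P) :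
    0 < orderPolytopeFunctional i (orderPolytopeCenter P) := by
  rcases i with c | v
  · rw [orderPolytopeFunctional_inl, orderPolytopeCenter, orderPolytopeCenter,
      if_pos (hP.isMin_of_lt c.2), if_neg (not_isMin_of_lt c.2)]
    norm_num
  · by_cases hv : IsMin v
    · norm_num [orderPolytopeFunctional_inr_of_isMin hv, orderPolytopeCenter, hv]
    · norm_num [orderPolytopeFunctional_inr_of_not_isMin hv, orderPolytopeCenter, hv]

theorem orderPolytopeFunctional_inl_facetPoint_pos (hP : IsGradedOfRankOne P)
    {i : OrderPolytopeIndex P} {c : {c : P × P // c.1 < c.2}} (hi : Sum.inl c ≠ i) :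
    0 < orderPolytopeFunctional (Sum.inl c) (orderPolytopeFacetPoint i) := by
  obtain ⟨⟨a, b⟩, hab : a < b⟩ := c
  have ha : IsMin a := hP.isMin_of_lt hab
  have hb : ¬ IsMin b := not_isMin_of_lt hab
  rw [orderPolytopeFunctional_inl, sub_pos]
  rcases i with ⟨⟨a', b'⟩, hab' : a' < b'⟩ | u
  · have hab_ne : a ≠ b' := fun h => not_isMin_of_lt hab' (h ▸ ha)
    have hba_ne : b ≠ a' := fun h => hb (h ▸ hP.isMin_of_lt hab')
    by_cases haa : a = a'
    · have hbb : b ≠ b' := fun hbb => hi (by simp [haa, hbb])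
      norm_num [orderPolytopeFacetPoint, orderPolytopeCenter, ← haa, ha, hb, hab.ne', hbb]
    · simp only [orderPolytopeFacetPoint, orderPolytopeCenter, haa, ha, hb, hab_ne, hba_ne,
        or_self, false_or, if_true, if_false]
      split_ifs <;> norm_num
  · simp only [orderPolytopeFacetPoint, orderPolytopeCenter, ha, hb, if_true, if_false]
    split_ifs <;> norm_num

theorem isIrredundant_orderPolytopeFunctional (hP : IsGradedOfRankOne P) :
    IsIrredundant (orderPolytopeFunctional (P := P)) where
  exists_forall_pos := ⟨orderPolytopeCenter P, hP.orderPolytopeFunctional_center_pos⟩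
  exists_eq_zero_and_forall_pos i := by
    refine ⟨orderPolytopeFacetPoint i, orderPolytopeFunctional_facetPoint i, ?_⟩
    rintro (c | v) hi
    exacts [hP.orderPolytopeFunctional_inl_facetPoint_pos hi,
      orderPolytopeFunctional_inr_facetPoint_pos hi]

theorem sumElim_orderPolytopeRelation_ne_iff (hP : IsGradedOfRankOne P) {C : Type*}
    {x : P → C ⊕ Bool} :
    (∀ i, Sum.elim x Sum.inr (orderPolytopeRelation i).1 ≠
        Sum.elim x Sum.inr (orderPolytopeRelation i).2) ↔
      (∀ a b, (SimpleGraph.hasse P).Adj a b → x a ≠ x b) ∧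
        ∀ v, x v ≠ Sum.inr (hP.rankColoring v) := by
  classical
  rw [Sum.forall, Subtype.forall, Prod.forall]
  refine and_congr ⟨fun h a b hab => ?_, fun h a b hab => h a b (hP.hasse_adj.2 (Or.inl hab))⟩
    (forall_congr' fun v => ?_)
  · exact (hP.hasse_adj.1 hab).elim (h a b) fun hba => (h b a hba).symm
  · by_cases hv : IsMin v
    · simp [orderPolytopeRelation, rankColoring_apply, hv, eq_comm]
    · simp [orderPolytopeRelation, rankColoring_apply, hv]

theorem natCard_sumElim_orderPolytopeRelation_ne [Fintype P] (hP : IsGradedOfRankOne P)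
    (C : Type*) [Finite C] :
    Nat.card {x : P → C ⊕ Bool // ∀ i, Sum.elim x Sum.inr (orderPolytopeRelation i).1 ≠
        Sum.elim x Sum.inr (orderPolytopeRelation i).2} =
      ∑ W : Finset P, Nat.card (((SimpleGraph.hasse P).induce (W : Set P)).Coloring C) := by
  rw [← natCard_coloring_ne_inr hP.rankColoring]
  exact Nat.card_congr
    { toFun x :=
        have hx := hP.sumElim_orderPolytopeRelation_ne_iff.1 x.2
        ⟨SimpleGraph.Coloring.mk x.1 fun {a b} => hx.1 a b, hx.2⟩
      invFun c := ⟨c.1, hP.sumElim_orderPolytopeRelation_ne_iff.2 ⟨fun _ _ => c.1.valid, c.2⟩⟩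
      left_inv _ := rfl
      right_inv _ := rfl }

theorem whitneyPolynomial_orderPolytopeFunctional [Fintype P] [Fintype (OrderPolytopeIndex P)]
    (hP : IsGradedOfRankOne P) :
    whitneyPolynomial (fun i : OrderPolytopeIndex P => zeroLocus (orderPolytopeFunctional i))
      Finset.univ ⊤ =
    ∑ W : Finset P, ((SimpleGraph.hasse P).induce (W : Set P)).chromaticPolynomial.comp
      (Polynomial.X - Polynomial.C 2) := by
  have hinf : (Set.range fun q : ℕ => (q : ℤ) + 2).Infinite :=
    Set.infinite_range_of_injective fun a b h => by simpa using h
  refine Polynomial.eq_of_infinite_eval_eq _ _ (hinf.mono ?_)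
  rintro _ ⟨q, rfl⟩
  have hκ : Function.Injective fun b : Bool => if b then (1 : ℝ) else 0 := by
    rintro (_ | _) (_ | _) <;> simp
  have heval := eval_whitneyPolynomial_natCard (orderPolytopeRelation (P := P)) hκ
    (Sum.inr_injective (α := Fin q) (β := Bool))
  have hq : (Nat.card (Fin q ⊕ Bool) : ℤ) = q + 2 := by simp
  rw [hq, hP.natCard_sumElim_orderPolytopeRelation_ne, Nat.cast_sum] at heval
  refine heval.trans ?_
  rw [Polynomial.eval_finsetSum]
  refine Finset.sum_congr rfl fun W _ => ?_
  rw [Polynomial.eval_comp, ← SimpleGraph.eval_chromaticPolynomial]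
  simp

theorem characteristicPolynomial_range_zeroLocus [Fintype P] (hP : IsGradedOfRankOne P)
    (hA : (Set.range fun i : OrderPolytopeIndex P =>
      zeroLocus (orderPolytopeFunctional i)).Finite) :
    characteristicPolynomial _ hA =
      ∑ W : Finset P, ((SimpleGraph.hasse P).induce (W : Set P)).chromaticPolynomial.comp
        (Polynomial.X - Polynomial.C 2) := by
  have := Fintype.ofFinite (OrderPolytopeIndex P)
  rw [characteristicPolynomial_range hP.isIrredundant_orderPolytopeFunctional.zeroLocus_ne_top,
    hP.whitneyPolynomial_orderPolytopeFunctional]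

end IsGradedOfRankOne

end OrderPolytope

theorem mainTheorem7 (P : Type*) [PartialOrder P] [Fintype P] (hP : IsGradedOfRankOne P) :
    ∃ hA : (visibilityArrangement (orderPolytope P)).Finite,
      characteristicPolynomial (visibilityArrangement (orderPolytope P)) hA =
          ∑ W : Finset P,
            ((SimpleGraph.hasse P).induce (W : Set P)).chromaticPolynomial.comp
              (Polynomial.X - Polynomial.C 2) ∧
      (regions (visibilityArrangement (orderPolytope P))).Finite ∧
      (visibilityNumber (orderPolytope P) : ℤ) =
          (-1) ^ Fintype.card P *
            ∑ W : Finset P,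
              ((SimpleGraph.hasse P).induce (W : Set P)).chromaticPolynomial.eval (-3) ∧
      (visibilitySets (orderPolytope P)).ncard = visibilityNumber (orderPolytope P) := by
  have := Fintype.ofFinite (OrderPolytopeIndex P)
  have hl := hP.isIrredundant_orderPolytopeFunctional
  have hcont (i : OrderPolytopeIndex P) : Continuous (orderPolytopeFunctional i) :=
    (orderPolytopeFunctional i).continuous_of_finiteDimensional
  have hvis := hl.visibilityArrangement_polyhedron
  have hsets := hl.ncard_visibilitySets_polyhedron
  rw [hP.polyhedron_orderPolytopeFunctional] at hvis hsets
  rw [visibilityNumber, hsets, hvis]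
  have hA := Set.finite_range fun i : OrderPolytopeIndex P => zeroLocus (orderPolytopeFunctional i)
  have hχ := hP.characteristicPolynomial_range_zeroLocus hA
  refine ⟨hA, hχ, finite_regions hcont, ?_, (ncard_regions hcont).symm⟩
  rw [ncard_regions_eq_eval_characteristicPolynomial hl.zeroLocus_ne_top hA, hχ,
    finrank_fintype_fun_eq_card, Polynomial.eval_finsetSum]
  simp [Polynomial.eval_comp]
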